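/- Let $A\in\mathbb R^{m\times n}$ with $m\ge 1$, with columns $a_1,\dots,a_n$ and $\mathrm{rk}(A)=m$, be such that $A^{\mathsf T}y>0$ has a solution, and let $$\rho_A=\max_{y\in\mathrm{im}(A)\setminus\{0\}}\ \min_{1\le j\le n}\ \frac{a_j^{\mathsf T}y}{\|a_j\|\,\|y\|}$$ be its Goffin measure. For a positive definite $Q\in\mathbb R^{m\times m}$ write $\|v\|_Q=\sqrt{v^{\mathsf T}Qv}$ and $\varepsilon=\frac1{11m}$. The Full Support Image Algorithm starts with $R=Q=I_m$. In each round it runs a first order method in the scalar product $u^{\mathsf T}Qv$ on the normalized columns $a_i/\|a_i\|_Q$, until this method returns $x\ge 0$ with $\sum_i x_i=1$ and $y=\sum_i x_i a_i/\|a_i\|_Q$ such that $A^{\mathsf T}Qy>0$ or $\|y\|_Q\le\varepsilon$. If $A^{\mathsf T}Qy>0$, the algorithm stops and returns $\bar y=Qy$; otherwise it sets $$R:=\frac1{1+\varepsilon}\Big(R+\sum_{i=1}^n\frac{x_i}{\|a_i\|_Q^2}\,a_ia_i^{\mathsf T}\Big),\qquad Q:=R^{-1},$$ and starts the next round. If the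 first order method is the Smoothed Perceptron of Peña and Soheili, or if it is the Mirror Prox method for feasibility problems of Yu, Kılınç-Karzan and Carbonell, then the algorithm terminates and returns a vector $\bar y$ with $A^{\mathsf T}\bar y>0$, after $$O\big(m^2\sqrt{\log(n+1)}\,(1+\log\rho_A^{-1})\big)$$ iterations of the first order method in total, and after $$O\big(m^3n\sqrt{\log(n+1)}\,(1+\log\rho_A^{-1})\big)$$ arithmetic operations on real numbers (including comparisons and evaluations of the square root, exponential and logarithm). If $A$ has integer entries and total binary encoding length $L=\sum_{i,j}\big(1+\lceil\log_2(|a_{ij}|+1)\rceil\big)$, the number of arithmetic operations is $O\big(m^3n\sqrt{\log(n+1)}\;L\big)$. The constants in the $O$-notation are absolute. -/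

import Mathlib

open scoped Matrix

namespace ImageRescaling

noncomputable section

abbrev Vec (n : ℕ) := Fin n → ℝ

abbrev Mat (m n : ℕ) := Matrix (Fin m) (Fin n) ℝ

/-! ### The condition measure and the encoding length -/

/-- The Euclidean norm of a real vector. -/
def euclNorm {m : ℕ} (v : Vec m) : ℝ := ‖WithLp.toLp 2 v‖

/-- The unit vector `v / ‖v‖` in the direction of `v`, with the value `0` at `v = 0`. -/
def unitVec {m : ℕ} (v : Vec m) : Vec m := (euclNorm v)⁻¹ • v

/-- The Goffin measure of `A`: the maximum, over the nonzero vectors `y` of the column space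
of `A`, of the minimum over the columns `a_j` of the cosine of the angle between `a_j` and `y`. -/
def goffin {m n : ℕ} (A : Mat m n) : ℝ :=
  ⨆ y : {y : Vec m // y ∈ LinearMap.range A.mulVecLin ∧ y ≠ 0},
    ⨅ j : Fin n, unitVec (A.col j) ⬝ᵥ unitVec y.1

/-- Total binary encoding length of an integer matrix: an entry `z` takes one bit for the sign
and `⌈log₂ (|z| + 1)⌉` bits for the absolute value. -/
def encodingLength {m n : ℕ} (A : Matrix (Fin m) (Fin n) ℤ) : ℕ :=
  ∑ i, ∑ j, (1 + (A i j).natAbs.size)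

/-! ### Computations over the reals with operation counts -/

/-- A computation together with its result, the number `ops` of operations on real
numbers that it performs, and the number `iters` of iterations of the first order method. -/
structure Counted (α : Type) where
  val : α
  ops : ℕ
  iters : ℕ

namespace Counted

instance : Monad Counted where
  pure a := ⟨a, 0, 0⟩
  bind p f := ⟨(f p.val).val, p.ops + (f p.val).ops, p.iters + (f p.val).iters⟩

/-! The primitive operations on real numbers. Each of them costs one operation. -/

def add (x y : ℝ) : Counted ℝ := ⟨x + y, 1, 0⟩
def sub (x y : ℝ) : Counted ℝ := ⟨x - y, 1, 0⟩
def mul (x y : ℝ) : Counted ℝ := ⟨x * y, 1, 0⟩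
def div (x y : ℝ) : Counted ℝ := ⟨x / y, 1, 0⟩
def max (x y : ℝ) : Counted ℝ := ⟨Max.max x y, 1, 0⟩
def sqrt (x : ℝ) : Counted ℝ := ⟨Real.sqrt x, 1, 0⟩
def exp (x : ℝ) : Counted ℝ := ⟨Real.exp x, 1, 0⟩
def log (x : ℝ) : Counted ℝ := ⟨Real.log x, 1, 0⟩

open Classical in
def le (x y : ℝ) : Counted Bool := ⟨decide (x ≤ y), 1, 0⟩

open Classical in
/-- Comparison of all the `n` coordinates of a vector with zero. -/
def allPos {n : ℕ} (v : Vec n) : Counted Bool := ⟨decide (∀ j, 0 < v j), n, 0⟩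

/-- Marks the execution of one iteration of the first order method. -/
def iteration : Counted Unit := ⟨(), 0, 1⟩

/-- Computes the coordinates of a vector one after the other. -/
def tabulate {n : ℕ} (f : Fin n → Counted ℝ) : Counted (Vec n) :=
  ⟨fun i => (f i).val, ∑ i, (f i).ops, ∑ i, (f i).iters⟩

/-- Computes the entries of a matrix one after the other. -/
def matrix {m n : ℕ} (f : Fin m → Fin n → Counted ℝ) : Counted (Mat m n) :=
  ⟨Matrix.of fun i j => (f i j).val, ∑ i, ∑ j, (f i j).ops, ∑ i, ∑ j, (f i j).iters⟩

/-- Computes `n` terms and adds them up, starting from zero, with `n` additions. -/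
def sum {n : ℕ} (f : Fin n → Counted ℝ) : Counted ℝ :=
  ⟨∑ i, (f i).val, (∑ i, (f i).ops) + n, ∑ i, (f i).iters⟩

/-- A loop. The body either gives the next state or exits with a result. The first argument
bounds the number of passes; `none` means that the loop has not been left within this bound. -/
def loop {σ τ : Type} (body : σ → Counted (σ ⊕ τ)) : ℕ → σ → Counted (Option τ)
  | 0, _ => pure none
  | N + 1, s => do
    match ← body s with
    | .inl s' => loop body N s'
    | .inr r => pure (some r)

/-! Linear algebra. A transposition or the selection of a row or column only renames indices
and is free of arithmetic. -/

def dot {n : ℕ} (u v : Vec n) : Counted ℝ := sum fun i => mul (u i) (v i)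

def mulVec {m n : ℕ} (M : Mat m n) (v : Vec n) : Counted (Vec m) :=
  tabulate fun i => dot (M.row i) v

/-- `‖v‖_Q ^ 2 = vᵀ Q v`. -/
def sqNorm {m : ℕ} (Q : Mat m m) (v : Vec m) : Counted ℝ := do
  dot v (← mulVec Q v)

/-- `‖v‖_Q`. -/
def qNorm {m : ℕ} (Q : Mat m m) (v : Vec m) : Counted ℝ := do
  sqrt (← sqNorm Q v)

/-- One step of the inversion of `R`: if `Q` is the inverse of a matrix whose `k`-th row is that
of the identity, the result is the inverse of the same matrix with the `k`-th row of `R` in its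
place (Sherman–Morrison formula). -/
def inverseStep {m : ℕ} (R : Mat m m) (Q : Mat m m) (k : Fin m) : Counted (Mat m m) := do
  let v ← tabulate fun i => sub (R k i) ((1 : Mat m m) k i)
  let u ← mulVec Qᵀ v
  let d ← add 1 (u k)
  matrix fun i j => do
    sub (Q i j) (← div (← mul (Q i k) (u j)) d)

/-- The inverse of a positive definite matrix `R`, computed by starting from the identity and
inserting the rows of `R` one by one. -/
def inverse {m : ℕ} (R : Mat m m) : Counted (Mat m m) :=
  (List.finRange m).foldlM (inverseStep R) 1

@[simp] theorem val_bind {α β : Type} (p : Counted α) (f : α → Counted β) :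
    (p >>= f).val = (f p.val).val := rfl

theorem inverseStep_val {m : ℕ} (R Q : Mat m m) (k : Fin m) :
    (inverseStep R Q k).val = Q - (1 + (Matrix.vecMul (R k - (1 : Mat m m) k) Q) k)⁻¹ •
      Matrix.vecMulVec (Q.col k) (Matrix.vecMul (R k - (1 : Mat m m) k) Q) := by
  have h : (mulVec Qᵀ (fun i => R k i - (1 : Mat m m) k i)).val =
      Matrix.vecMul (R k - (1 : Mat m m) k) Q := by
    ext j
    simp [mulVec, tabulate, dot, sum, mul, Matrix.vecMul, dotProduct, mul_comm]
  have h2 : (inverseStep R Q k).val = Matrix.of fun i j => Q i j - Q i k *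
    (mulVec Qᵀ (fun i => R k i - (1 : Mat m m) k i)).val j /
    (1 + (mulVec Qᵀ (fun i => R k i - (1 : Mat m m) k i)).val k) := rfl
  rw [h2, h]
  ext i j
  simp [Matrix.vecMulVec_apply, div_eq_inv_mul]

theorem inverse_aux {m : ℕ} (R : Mat m m) (hR : R.PosDef) (l : List (Fin m)) :
    ∀ (S : Finset (Fin m)) (Q : Mat m m), l.Nodup → (∀ i ∈ l, i ∉ S) →
      Q * (Matrix.of fun i j => if i ∈ S then R i j else (1 : Mat m m) i j) = 1 →
      (l.foldlM (inverseStep R) Q).val *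
        (Matrix.of fun i j => if i ∈ S ∪ l.toFinset then R i j else (1 : Mat m m) i j) = 1 := by
  classical
  induction l with
  | nil => intro S Q _ _ h; change Q * _ = 1; simpa using h
  | cons k l ih =>
    intro S Q hnd hS hQ
    rw [List.foldlM_cons, val_bind]
    have hk : k ∉ S := hS k (by simp)
    have := ih (insert k S) (inverseStep R Q k).val (List.nodup_cons.1 hnd).2 (by
      intro i hi
      have h1 := hS i (by simp [hi])
      have h2 : i ≠ k := fun h => (List.nodup_cons.1 hnd).1 (h ▸ hi)
      simp [h1, h2]) ?_
    · convert this using 5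
      simp
    · set M : Mat m m := Matrix.of fun i j => if i ∈ S then R i j else (1 : Mat m m) i j with hM
      set M' : Mat m m :=
        Matrix.of fun i j => if i ∈ insert k S then R i j else (1 : Mat m m) i j with hM'
      set v := R k - (1 : Mat m m) k with hv
      have hMM : M' = M + Matrix.vecMulVec (Pi.single k 1) v := by
        ext i j
        by_cases hik : i = k
        · subst hik; simp [hM, hM', hv, hk, Matrix.vecMulVec_apply]
        · simp [hM, hM', hik, Matrix.vecMulVec_apply]
      have hcol : Q.col k = Q *ᵥ (Pi.single k 1) := by simp
      have hdet : ∀ x, M' *ᵥ x = 0 → x = 0 := by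
        intro x hx
        by_contra hne
        have h1 := hR.dotProduct_mulVec_pos hne
        have h2 : ∀ i, x i * (R *ᵥ x) i = 0 := by
          intro i
          have h3 := congrFun hx i
          by_cases hi : i ∈ insert k S
          · have : (M' *ᵥ x) i = (R *ᵥ x) i := by
              simp only [Matrix.mulVec, dotProduct, hM', Matrix.of_apply, if_pos hi]
            rw [← this, h3]; simp
          · have : (M' *ᵥ x) i = ((1 : Mat m m) *ᵥ x) i := by
              simp only [Matrix.mulVec, dotProduct, hM', Matrix.of_apply, if_neg hi]
            rw [this] at h3
            simp at h3
            simp [h3]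
        simp [dotProduct, h2] at h1
      have hu : 1 + (Matrix.vecMul v Q) k ≠ 0 := by
        intro h0
        have hMQ : M * Q = 1 := mul_eq_one_comm.1 hQ
        have h1 : M' *ᵥ (Q.col k) = 0 := by
          rw [hcol, hMM, Matrix.add_mulVec, Matrix.mulVec_mulVec, hMQ, Matrix.one_mulVec,
            Matrix.vecMulVec_mulVec, Matrix.dotProduct_mulVec, dotProduct_single_one,
            show (Matrix.vecMul v Q) k = -1 by linarith]
          ext i; simp
        have h2 := hdet _ h1
        have h3 : M *ᵥ (Q.col k) = Pi.single k 1 := by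
          rw [hcol, Matrix.mulVec_mulVec, hMQ, Matrix.one_mulVec]
        rw [h2] at h3
        simpa using congrFun h3 k
      rw [inverseStep_val, hMM, ← hv, Matrix.mul_add, Matrix.sub_mul, Matrix.sub_mul, hQ,
        Matrix.smul_mul, Matrix.smul_mul, Matrix.mul_vecMulVec, ← hcol,
        Matrix.vecMulVec_mul, Matrix.vecMulVec_mul_vecMulVec, Matrix.vecMul_vecMul, hQ,
        Matrix.vecMul_one, dotProduct_single_one]
      ext i j
      simp [Matrix.vecMulVec_apply]
      field_simp
      ring

/-- On positive definite matrices `inverse` does compute the inverse. -/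
theorem inverse_val {m : ℕ} (R : Mat m m) (hR : R.PosDef) : (inverse R).val = R⁻¹ := by
  have h := inverse_aux R hR (List.finRange m) ∅ 1 (List.nodup_finRange m) (by simp) (by
    ext i j; simp)
  have h2 : (inverse R).val * R = 1 := by
    have h3 : (Matrix.of fun i j => if i ∈ ∅ ∪ (List.finRange m).toFinset then R i j
        else (1 : Mat m m) i j) = R := by
      ext i j; simp
    rw [h3] at h
    exact h
  exact (Matrix.inv_eq_left_inv h2).symm

end Counted

open Counted

/-! ### First order methods

Both methods get the matrix `B` with columns `a_j / ‖a_j‖_Q`, and run in the scalar product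
`⟨u, v⟩_Q = uᵀ Q v`. They return a pair `(x, y)` with `x ≥ 0`, `∑ x_j = 1`, `y = B x` and either
`Bᵀ Q y > 0` or `‖y‖_Q ≤ ε`. -/

/-- The matrix with columns `a_j / ‖a_j‖_Q`. -/
def normalizeColumns {m n : ℕ} (A : Mat m n) (Q : Mat m m) : Counted (Mat m n) := do
  let s ← tabulate fun j => qNorm Q (A.col j)
  matrix fun i j => div (A i j) (s j)

/-- The vector `Bᵀ Q y` of scalar products `⟨b_j, y⟩_Q`. -/
def scores {m n : ℕ} (B : Mat m n) (Q : Mat m m) (y : Vec m) : Counted (Vec n) := do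
  mulVec Bᵀ (← mulVec Q y)

/-- Division of a vector by the sum of its coordinates. -/
def toSimplex {n : ℕ} (e : Vec n) : Counted (Vec n) := do
  let s ← Counted.sum fun j => pure (e j)
  tabulate fun j => div (e j) s

/-- The entropy-smoothed minimizer of `⟨g, x⟩` over the unit simplex: the minimizer of
`⟨g, x⟩ + μ ∑ x_j log x_j`, which has coordinates proportional to `exp (-g_j / μ)`. -/
def softMin {n : ℕ} (g : Vec n) (μ : ℝ) : Counted (Vec n) := do
  let e ← tabulate fun j => do exp (← sub 0 (← div (g j) μ))
  toSimplex e

/-! #### The Smoothed Perceptron of Peña and Soheili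

Iterates `y_k` and `x_k` with `y_0 = B e / n`, `μ_0 = 2`, `x_0 = x_{μ_0}(y_0)`, and for
`θ_k = 2 / (k + 3)`:
`y_{k+1} = (1 - θ_k) (y_k + θ_k B x_k) + θ_k² B x_{μ_k}(y_k)`, `μ_{k+1} = (1 - θ_k) μ_k`,
`x_{k+1} = (1 - θ_k) x_k + θ_k x_{μ_{k+1}}(y_{k+1})`, where `x_μ(y)` is `softMin (Bᵀ Q y) μ`.
It stops when `Bᵀ Q y_k > 0` or `‖B x_k‖_Q ≤ ε`. -/

/-- The vector `y_k` is kept as `y_k = B w`. -/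
structure SPState (n : ℕ) where
  k : ℝ
  μ : ℝ
  w : Vec n
  x : Vec n

def spInit {m n : ℕ} (B : Mat m n) (Q : Mat m m) : Counted (SPState n) := do
  let w ← tabulate fun _ => div 1 n
  let g ← scores B Q (← mulVec B w)
  let x ← softMin g 2
  pure ⟨0, 2, w, x⟩

def spUpdate {m n : ℕ} (B : Mat m n) (Q : Mat m m) (s : SPState n) (g : Vec n) :
    Counted (SPState n) := do
  iteration
  let θ ← div 2 (← add s.k 3)
  let θ' ← sub 1 θ
  let θ2 ← mul θ θ
  let p ← softMin g s.μ
  let w' ← tabulate fun j => do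
    add (← mul θ' (← add (s.w j) (← mul θ (s.x j)))) (← mul θ2 (p j))
  let μ' ← mul θ' s.μ
  let g' ← scores B Q (← mulVec B w')
  let p' ← softMin g' μ'
  let x' ← tabulate fun j => do add (← mul θ' (s.x j)) (← mul θ (p' j))
  let k' ← add s.k 1
  pure ⟨k', μ', w', x'⟩

def spBody {m n : ℕ} (B : Mat m n) (Q : Mat m m) (ε : ℝ) (s : SPState n) :
    Counted (SPState n ⊕ (Vec n × Vec m)) := do
  let y ← mulVec B s.w
  let g ← scores B Q y
  if ← allPos g then
    pure (.inr (s.w, y))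
  else
    let z ← mulVec B s.x
    if ← le (← qNorm Q z) ε then
      pure (.inr (s.x, z))
    else
      let s' ← spUpdate B Q s g
      pure (.inl s')

def smoothedPerceptron {m n : ℕ} (N : ℕ) (B : Mat m n) (Q : Mat m m) (ε : ℝ) :
    Counted (Option (Vec n × Vec m)) := do
  let s ← spInit B Q
  loop (spBody B Q ε) N s

/-! #### The Mirror Prox method for feasibility problems of Yu, Kılınç-Karzan and Carbonell

Mirror Prox for the saddle point problem `min_x max_y ⟨y, B x⟩_Q` with `x` in the unit simplex
and `‖y‖_Q ≤ 1`, with the entropy as distance generating function for `x` and `‖y‖_Q² / 2` for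
`y`, starting from `x = e / n` and `y = 0`. From `z_t` it makes the prox-step to `w_t` along the
gradient at `z_t`, and then the prox-step from `z_t` to `z_{t+1}` along the gradient at `w_t`.
With `(x̄, ȳ)` the average of `w_1, …, w_t`, it stops when `Bᵀ Q ȳ > 0` or `‖B x̄‖_Q ≤ ε`. -/

/-- The current point `z_t` and the sum of the points `w_1, …, w_t`. Points `y` of the ball are
kept as `y = B v` with `v ≥ 0`. -/
structure MPState (n : ℕ) where
  t : ℝ
  x : Vec n
  v : Vec n
  xSum : Vec n
  vSum : Vec n

/-- The prox-step from `(x, B v)` along the gradient at `(x₀, B v₀)`: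
`x_j` is replaced by a multiple of `x_j exp (-σ ⟨b_j, B v₀⟩_Q)` and `B v` by the projection of
`B v + B x₀ / σ` to the unit ball. -/
def mpProx {m n : ℕ} (B : Mat m n) (Q : Mat m m) (σ : ℝ) (x v x₀ v₀ : Vec n) :
    Counted (Vec n × Vec n) := do
  let g ← scores B Q (← mulVec B v₀)
  let e ← tabulate fun j => do mul (x j) (← exp (← sub 0 (← mul σ (g j))))
  let x' ← toSimplex e
  let u ← tabulate fun j => do add (v j) (← div (x₀ j) σ)
  let r ← qNorm Q (← mulVec B u)
  let d ← Counted.max 1 r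
  let v' ← tabulate fun j => div (u j) d
  pure (x', v')

def mpBody {m n : ℕ} (B : Mat m n) (Q : Mat m m) (ε σ : ℝ) (s : MPState n) :
    Counted (MPState n ⊕ (Vec n × Vec m)) := do
  iteration
  let p ← mpProx B Q σ s.x s.v s.x s.v
  let z ← mpProx B Q σ s.x s.v p.1 p.2
  let t ← add s.t 1
  let xSum ← tabulate fun j => add (s.xSum j) (p.1 j)
  let vSum ← tabulate fun j => add (s.vSum j) (p.2 j)
  let xAvg ← tabulate fun j => div (xSum j) t
  let vAvg ← tabulate fun j => div (vSum j) t
  let g ← scores B Q (← mulVec B vAvg)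
  if ← allPos g then
    let w ← toSimplex vAvg
    let y ← mulVec B w
    pure (.inr (w, y))
  else
    let y ← mulVec B xAvg
    if ← le (← qNorm Q y) ε then
      pure (.inr (xAvg, y))
    else
      pure (.inl ⟨t, z.1, z.2, xSum, vSum⟩)

/-- The step sizes `σ = √(2 log (n + 1))` for `x` and `1 / σ` for `y` balance the diameters
`log n` of the simplex and `1 / 2` of the ball; `n + 1` makes `σ` positive for `n = 1`. -/
def mirrorProx {m n : ℕ} (N : ℕ) (B : Mat m n) (Q : Mat m m) (ε : ℝ) :
    Counted (Option (Vec n × Vec m)) := do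
  let σ ← sqrt (← mul 2 (← log (← add n 1)))
  let x ← tabulate fun _ => div 1 n
  loop (mpBody B Q ε σ) N ⟨0, x, 0, 0, 0⟩

inductive FirstOrderMethod where
  | smoothedPerceptron
  | mirrorProx

/-- A call of the first order method for the columns of `A` and the scalar product of `Q`. -/
def FirstOrderMethod.call {m n : ℕ} (method : FirstOrderMethod) (N : ℕ) (A : Mat m n)
    (Q : Mat m m) (ε : ℝ) : Counted (Option (Vec n × Vec m)) := do
  let B ← normalizeColumns A Q
  match method with
  | .smoothedPerceptron => ImageRescaling.smoothedPerceptron N B Q ε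
  | .mirrorProx => ImageRescaling.mirrorProx N B Q ε

/-! ### The Full Support Image Algorithm -/

/-- `R := (R + ∑ x_l a_l a_lᵀ / ‖a_l‖_Q²) / (1 + ε)` and `Q := R⁻¹`; the result is `(R, Q)`. -/
def rescale {m n : ℕ} (A : Mat m n) (ε : ℝ) (R Q : Mat m m) (x : Vec n) :
    Counted (Mat m m × Mat m m) := do
  let c ← tabulate fun l => do div (x l) (← sqNorm Q (A.col l))
  let δ ← add 1 ε
  let R' ← matrix fun i j => do
    let s ← Counted.sum fun l => do mul (c l) (← mul (A i l) (A j l))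
    div (← add (R i j) s) δ
  let Q' ← inverse R'
  pure (R', Q')

/-- One pass of the main loop, on the state `(R, Q)`: call the first order method to obtain
`(x, y)`; if `Aᵀ Q y > 0` then return `Q y`, and otherwise rescale. -/
def imageBody {m n : ℕ} (method : FirstOrderMethod) (N : ℕ) (A : Mat m n) (ε : ℝ)
    (s : Mat m m × Mat m m) : Counted ((Mat m m × Mat m m) ⊕ Option (Vec m)) := do
  match ← method.call N A s.2 ε with
  | none => pure (.inr none)
  | some (x, y) =>
    let q ← mulVec s.2 y
    let g ← mulVec Aᵀ q
    if ← allPos g then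
      pure (.inr (some q))
    else
      let s' ← rescale A ε s.1 s.2 x
      pure (.inl s')

/-- The Full Support Image Algorithm with `ε = 1 / (11 m)` and with the given first order method.
The number `N` only bounds the number of passes through each loop of the formal description and
is not used otherwise: the result is `some ȳ` if the algorithm stops within this bound and returns
`ȳ`, and `none` if some loop is still running. In the former case the counts of operations and
iterations are those of the complete run and do not depend on `N`. -/
def imageAlgorithm {m n : ℕ} (method : FirstOrderMethod) (A : Mat m n) (N : ℕ) :
    Counted (Option (Vec m)) := do
  let ε ← div 1 (← mul 11 m)
  let r ← loop (imageBody method N A ε) N (1, 1)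
  pure r.join

end

end ImageRescaling

namespace ImageRescaling

section FirstOrderAnalysis

/-! ### Relative entropy on the unit simplex -/

/-! The number of rescalings is bounded by a volume argument with `det R` as potential. Every `z`
with `Aᵀ z ≥ 0` keeps `zᵀ R z ≤ zᵀ z`: such a `z` has nonnegative products with the columns, so by
Cauchy–Schwarz for the dual norms of `Q = R⁻¹` and `R` a rescaling adds at most `‖y‖_Q ‖z‖_R² ≤ ε
‖z‖_R²`, and the division by `1 + ε` undoes this (`dotProduct_rescaled_le`). Meanwhile the added
matrix has trace `1` relative to `R`, so `det R` at least doubles before the division, which costs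
only `(1 + ε)^m ≤ exp (1/11)`; a round gains a factor `exp (1/2)` (`det_rescaled_ge`). A Goffin
measure above `δ` puts a ball of radius `δ` around a unit vector into the cone, which forces `det R
≤ (2/δ²)^m`. Hence there are `O(m (1 + log ρ⁻¹))` rounds (`RescalingInv.le`).

A call of a first order method takes `O(√log (n+1) / ε) = O(m √log (n+1))` iterations. Both analyses
rest on Pinsker's inequality together with the fact that normalized columns make `x ↦ B x` a
contraction from the 1-norm. The Smoothed Perceptron preserves an excessive gap whose smoothing
parameter decays like `1/k²` (`excessiveGap_step`); Mirror Prox keeps its accumulated regret below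
`σ`, so averages over `t` iterations have error `σ/t` (`mirrorProx_step`). As long as some score is
nonpositive, testing with the corresponding vertex of the simplex turns these bounds into bounds on
`‖B x‖_Q`. Since `m ≤ n`, an iteration costs `O(mn)` and the remaining work of a round `O(m²n)`,
which `O(m)` iterations absorb.

For integer input, a vertex of `{y | a_jᵀ y ≥ 1}` has small coordinates by Cramer's rule
(`exists_cone_vector_of_int`), and its direction witnesses `log ρ⁻¹ = O(L)`. -/

theorem log_lower_bound {t : ℝ} (ht : 0 < t) :
    (t - 1) * (5 * t + 1) / (2 * t * (t + 2)) ≤ Real.log t := by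
  set g : ℝ → ℝ := fun t => Real.log t - (t - 1) * (5 * t + 1) / (2 * t * (t + 2)) with hg
  -- The derivative of the difference changes sign only at `1`, so the difference has its minimum
  -- `0` there.
  have hd : ∀ s : ℝ, 0 < s → HasDerivAt g ((s - 1) ^ 3 / (s ^ 2 * (s + 2) ^ 2)) s := by
    intro s hs
    have h1 := Real.hasDerivAt_log hs.ne'
    have hn : HasDerivAt (fun t : ℝ => (t - 1) * (5 * t + 1))
        (1 * (5 * s + 1) + (s - 1) * (5 * 1)) s :=
      ((hasDerivAt_id s).sub_const 1).mul (((hasDerivAt_id s).const_mul 5).add_const 1)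
    have hdn : HasDerivAt (fun t : ℝ => 2 * t * (t + 2)) (2 * 1 * (s + 2) + 2 * s * 1) s :=
      ((hasDerivAt_id s).const_mul 2).mul ((hasDerivAt_id s).add_const 2)
    have h2 := h1.sub (hn.div hdn (by positivity))
    refine h2.congr_deriv ?_
    field_simp
    ring
  have hg1 : g 1 = 0 := by simp [hg]
  suffices 0 ≤ g t by simp only [hg] at this; linarith
  rcases le_total 1 t with h | h
  · have hm : MonotoneOn g (Set.Ici 1) := by
      apply monotoneOn_of_deriv_nonneg (convex_Ici 1)
      · exact fun s hs => (hd s (by linarith [Set.mem_Ici.1 hs])).continuousAt.continuousWithinAt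
      · intro s hs
        rw [interior_Ici] at hs
        exact (hd s (by linarith [Set.mem_Ioi.1 hs])).differentiableAt.differentiableWithinAt
      · intro s hs
        rw [interior_Ici] at hs
        have hs1 : 1 < s := hs
        rw [(hd s (by linarith)).deriv]
        have : 0 ≤ s - 1 := by linarith
        positivity
    rw [← hg1]
    exact hm (Set.mem_Ici.2 le_rfl) (Set.mem_Ici.2 h) h
  · have hm : AntitoneOn g (Set.Ioc 0 1) := by
      apply antitoneOn_of_deriv_nonpos (convex_Ioc 0 1)
      · exact fun s hs => (hd s hs.1).continuousAt.continuousWithinAt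
      · intro s hs
        rw [interior_Ioc] at hs
        exact (hd s hs.1).differentiableAt.differentiableWithinAt
      · intro s hs
        rw [interior_Ioc] at hs
        rw [(hd s hs.1).deriv]
        apply div_nonpos_of_nonpos_of_nonneg _ (by positivity)
        have : 0 ≤ 1 - s := by linarith [hs.2]
        have h3 : 0 ≤ (1 - s) ^ 3 := by positivity
        nlinarith
    rw [← hg1]
    exact hm ⟨ht, h⟩ ⟨one_pos, le_rfl⟩ h

/-- The relative entropy of `p` with respect to `q`. -/
noncomputable def relEntropy {n : ℕ} (p q : Vec n) : ℝ := ∑ j, p j * Real.log (p j / q j)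

/-- The logarithm bound at `p / q`, multiplied by `p`. The correction `-p + q` cancels on summation
over two probability vectors, which gives Pinsker's inequality with the sharp constant. -/
theorem relEntropy_term_lower_bound {p q : ℝ} (hp : 0 ≤ p) (hq : 0 < q) :
    3 * ((p - q) ^ 2 / (2 * p + 4 * q)) ≤ p * Real.log (p / q) - p + q := by
  rcases hp.eq_or_lt with rfl | hp
  · simp only [zero_sub, zero_mul, mul_zero, zero_add, sub_zero]
    rw [← mul_div_assoc, div_le_iff₀ (by positivity)]
    nlinarith
  · have h := mul_le_mul_of_nonneg_left (log_lower_bound (div_pos hp hq)) hp.le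
    have h2 : p * ((p / q - 1) * (5 * (p / q) + 1) / (2 * (p / q) * (p / q + 2))) - p + q =
        3 * ((p - q) ^ 2 / (2 * p + 4 * q)) := by
      field_simp
      ring
    linarith

/-- Pinsker's inequality. -/
theorem pinsker {n : ℕ} {p q : Vec n} (hp : p ∈ stdSimplex ℝ (Fin n))
    (hq : q ∈ stdSimplex ℝ (Fin n)) (hq0 : ∀ j, 0 < q j) :
    (∑ j, |p j - q j|) ^ 2 ≤ 2 * relEntropy p q := by
  have h1 := Finset.sum_le_sum fun j (_ : j ∈ Finset.univ) =>
    relEntropy_term_lower_bound (hp.1 j) (hq0 j)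
  -- Cauchy–Schwarz in Engel form; the weights `2 p_j + 4 q_j` add up to `6`.
  have h2 := Finset.sq_sum_div_le_sum_sq_div Finset.univ (fun j => |p j - q j|)
    (g := fun j => 2 * p j + 4 * q j) fun j _ => by linarith [hp.1 j, hq0 j]
  simp only [Finset.sum_add_distrib, Finset.sum_sub_distrib, ← Finset.mul_sum, hp.2, hq.2,
    sq_abs] at h1 h2
  rw [relEntropy]
  have h3 : (∑ j, |p j - q j|) ^ 2 / (2 * 1 + 4 * 1) * 6 = (∑ j, |p j - q j|) ^ 2 := by ring
  linarith

variable {n : ℕ} {E : Type*} [NormedAddCommGroup E] [InnerProductSpace ℝ E]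

theorem norm_linearCombination_le {c : Fin n → E} (hc : ∀ j, ‖c j‖ ≤ 1) (v : Vec n) :
    ‖Fintype.linearCombination ℝ c v‖ ≤ ∑ j, |v j| := by
  rw [Fintype.linearCombination_apply]
  refine (norm_sum_le _ _).trans (Finset.sum_le_sum fun j _ => ?_)
  rw [norm_smul, Real.norm_eq_abs]
  exact mul_le_of_le_one_right (abs_nonneg _) (hc j)

/-- Vectors `c_j` in the unit ball make the combination map a contraction from the 1-norm, so
Pinsker's inequality passes to the images. -/
theorem norm_sub_sq_le_relEntropy {c : Fin n → E} (hc : ∀ j, ‖c j‖ ≤ 1) {p q : Vec n}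
    (hp : p ∈ stdSimplex ℝ (Fin n)) (hq : q ∈ stdSimplex ℝ (Fin n)) (hq0 : ∀ j, 0 < q j) :
    ‖Fintype.linearCombination ℝ c p - Fintype.linearCombination ℝ c q‖ ^ 2 ≤
      2 * relEntropy p q := by
  refine le_trans ?_ (pinsker hp hq hq0)
  rw [← map_sub]
  gcongr
  exact norm_linearCombination_le hc _

/-- The constant vector `1 / n`. -/
noncomputable def uniformVec (n : ℕ) : Vec n := fun _ => 1 / (n : ℝ)

theorem uniformVec_pos (hn : 0 < n) (j : Fin n) : 0 < uniformVec n j := by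
  unfold uniformVec; positivity

theorem uniformVec_mem (hn : 0 < n) : uniformVec n ∈ stdSimplex ℝ (Fin n) := by
  refine ⟨fun j => (uniformVec_pos hn j).le, ?_⟩
  have : (n : ℝ) ≠ 0 := by positivity
  simp [uniformVec, this]

theorem relEntropy_uniformVec_le (hn : 0 < n) {p : Vec n} (hp : p ∈ stdSimplex ℝ (Fin n)) :
    relEntropy p (uniformVec n) ≤ Real.log n := by
  have h : ∀ j, p j * Real.log (p j / uniformVec n j) ≤ p j * Real.log n := by
    intro j
    rcases (hp.1 j).eq_or_lt with h0 | h0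
    · simp [← h0]
    · apply mul_le_mul_of_nonneg_left _ h0.le
      have h1 : p j ≤ 1 := hp.2 ▸ Finset.single_le_sum (fun i _ => hp.1 i) (Finset.mem_univ j)
      have hn' : (0 : ℝ) < n := by positivity
      apply Real.log_le_log (div_pos h0 (uniformVec_pos hn j))
      rw [uniformVec, div_div_eq_mul_div, div_one]
      nlinarith
  refine (Finset.sum_le_sum fun j _ => h j).trans ?_
  rw [← Finset.sum_mul, hp.2, one_mul]

/-- The vector with coordinates proportional to `q_j exp (-h_j)`. -/
noncomputable def gibbs (q h : Vec n) : Vec n := fun j =>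
  q j * Real.exp (-h j) / ∑ i, q i * Real.exp (-h i)

theorem gibbs_denom_pos {q : Vec n} (hn : 0 < n) (hq : ∀ j, 0 < q j) (h : Vec n) :
    0 < ∑ i, q i * Real.exp (-h i) :=
  Finset.sum_pos (fun j _ => mul_pos (hq j) (Real.exp_pos _)) ⟨⟨0, hn⟩, Finset.mem_univ _⟩

theorem gibbs_pos {q : Vec n} (hn : 0 < n) (hq : ∀ j, 0 < q j) (h : Vec n) (j : Fin n) :
    0 < gibbs q h j :=
  div_pos (mul_pos (hq j) (Real.exp_pos _)) (gibbs_denom_pos hn hq h)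

theorem gibbs_mem {q : Vec n} (hn : 0 < n) (hq : ∀ j, 0 < q j) (h : Vec n) :
    gibbs q h ∈ stdSimplex ℝ (Fin n) := by
  refine ⟨fun j => (gibbs_pos hn hq h j).le, ?_⟩
  simp only [gibbs]
  rw [← Finset.sum_div, div_self (gibbs_denom_pos hn hq h).ne']

/-- Gibbs' variational identity: expand the logarithm of `gibbs q h` in each coordinate; coordinates
with `u_j = 0` contribute nothing. -/
theorem relEntropy_add_dotProduct {q : Vec n} (hn : 0 < n) (hq : ∀ j, 0 < q j) (h : Vec n)
    {u : Vec n} (hu : u ∈ stdSimplex ℝ (Fin n)) :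
    relEntropy u q + ∑ j, u j * h j =
      relEntropy u (gibbs q h) - Real.log (∑ i, q i * Real.exp (-h i)) := by
  have hZ := gibbs_denom_pos hn hq h
  have key : ∀ j, u j * Real.log (u j / gibbs q h j) = u j * Real.log (u j / q j) + u j * h j +
      u j * Real.log (∑ i, q i * Real.exp (-h i)) := by
    intro j
    rcases (hu.1 j).eq_or_lt with h0 | h0
    · simp [← h0]
    · rw [Real.log_div h0.ne' (gibbs_pos hn hq h j).ne', Real.log_div h0.ne' (hq j).ne', gibbs,
        Real.log_div (mul_pos (hq j) (Real.exp_pos _)).ne' hZ.ne',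
        Real.log_mul (hq j).ne' (Real.exp_pos _).ne', Real.log_exp]
      ring
  simp only [relEntropy, key, Finset.sum_add_distrib, ← Finset.sum_mul, hu.2]
  ring

theorem relEntropy_self {q : Vec n} (hq : ∀ j, 0 < q j) : relEntropy q q = 0 := by
  simp [relEntropy, fun j => div_self (hq j).ne']

/-- The three-point identity for the entropic prox-step. -/
theorem relEntropy_gibbs {q : Vec n} (hn : 0 < n) (hq : ∀ j, 0 < q j) (h : Vec n)
    {u : Vec n} (hu : u ∈ stdSimplex ℝ (Fin n)) :
    relEntropy u q + ∑ j, u j * h j =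
      relEntropy (gibbs q h) q + ∑ j, gibbs q h j * h j + relEntropy u (gibbs q h) := by
  rw [relEntropy_add_dotProduct hn hq h hu,
    relEntropy_add_dotProduct hn hq h (gibbs_mem hn hq h), relEntropy_self (gibbs_pos hn hq h)]
  ring

theorem relEntropy_nonneg {p q : Vec n} (hp : p ∈ stdSimplex ℝ (Fin n))
    (hq : q ∈ stdSimplex ℝ (Fin n)) (hq0 : ∀ j, 0 < q j) : 0 ≤ relEntropy p q := by
  nlinarith [pinsker hp hq hq0, sq_nonneg (∑ j, |p j - q j|)]

theorem sum_mul_inner (c : Fin n → E) (u : Vec n) (y : E) :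
    ∑ j, u j * inner ℝ (c j) y = inner ℝ y (Fintype.linearCombination ℝ c u) := by
  rw [Fintype.linearCombination_apply, inner_sum]
  simp [real_inner_smul_right, real_inner_comm]

/-! ### The Smoothed Perceptron -/

/-- The excessive gap condition of the Smoothed Perceptron. -/
def ExcessiveGap (c : Fin n → E) (μ : ℝ) (w x : Vec n) : Prop :=
  ∀ u ∈ stdSimplex ℝ (Fin n), ‖Fintype.linearCombination ℝ c x‖ ^ 2 / 2 ≤
    -(‖Fintype.linearCombination ℝ c w‖ ^ 2 / 2) +
      inner ℝ (Fintype.linearCombination ℝ c w) (Fintype.linearCombination ℝ c u) +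
      μ * relEntropy u (uniformVec n)

/-- The smoothed minimizer `x_μ(y)` for `y = ∑ w_j c_j`. -/
noncomputable def smoothedMin (c : Fin n → E) (μ : ℝ) (w : Vec n) : Vec n :=
  gibbs (uniformVec n) fun j => inner ℝ (c j) (Fintype.linearCombination ℝ c w) / μ

theorem smoothedMin_mem (hn : 0 < n) (c : Fin n → E) (μ : ℝ) (w : Vec n) :
    smoothedMin c μ w ∈ stdSimplex ℝ (Fin n) := gibbs_mem hn (uniformVec_pos hn) _

theorem smoothedMin_pos (hn : 0 < n) (c : Fin n → E) (μ : ℝ) (w : Vec n) (j : Fin n) :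
    0 < smoothedMin c μ w j := gibbs_pos hn (uniformVec_pos hn) _ j

/-- The three-point identity scaled by `μ`. Its last term says by how much `u` misses the smoothed
minimum; this surplus pays for the step of the algorithm. -/
theorem smoothedMin_identity (hn : 0 < n) (c : Fin n → E) {μ : ℝ} (hμ : 0 < μ) (w : Vec n)
    {u : Vec n} (hu : u ∈ stdSimplex ℝ (Fin n)) :
    inner ℝ (Fintype.linearCombination ℝ c w) (Fintype.linearCombination ℝ c u) +
        μ * relEntropy u (uniformVec n) =
      inner ℝ (Fintype.linearCombination ℝ c w)
          (Fintype.linearCombination ℝ c (smoothedMin c μ w)) +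
        μ * relEntropy (smoothedMin c μ w) (uniformVec n) +
        μ * relEntropy u (smoothedMin c μ w) := by
  have h := relEntropy_gibbs hn (uniformVec_pos hn)
    (fun j => inner ℝ (c j) (Fintype.linearCombination ℝ c w) / μ) hu
  rw [← smoothedMin] at h
  simp only [← mul_div_assoc, ← Finset.sum_div, sum_mul_inner] at h
  have h2 := congrArg (μ * ·) h
  simp only [mul_add, mul_div_cancel₀ _ hμ.ne'] at h2
  linarith

/-- The right-hand side of the gap condition is minimized over `u` at the smoothed minimizer, so
only that point has to be checked. -/
theorem excessiveGap_of_smoothedMin (hn : 0 < n) (c : Fin n → E) {μ : ℝ} (hμ : 0 < μ)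
    (w x : Vec n)
    (h : ‖Fintype.linearCombination ℝ c x‖ ^ 2 / 2 ≤
      -(‖Fintype.linearCombination ℝ c w‖ ^ 2 / 2) +
      inner ℝ (Fintype.linearCombination ℝ c w)
        (Fintype.linearCombination ℝ c (smoothedMin c μ w)) +
      μ * relEntropy (smoothedMin c μ w) (uniformVec n)) :
    ExcessiveGap c μ w x := by
  intro u hu
  have h1 := smoothedMin_identity hn c hμ w hu
  have h2 := mul_nonneg hμ.le
    (relEntropy_nonneg hu (smoothedMin_mem hn c μ w) (smoothedMin_pos hn c μ w))
  linarith

/-- Expanding the square in `norm_sub_sq_le_relEntropy` gives the condition even with `μ = 1`. -/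
theorem excessiveGap_init (hn : 0 < n) {c : Fin n → E} (hc : ∀ j, ‖c j‖ ≤ 1) :
    ExcessiveGap c 2 (uniformVec n) (smoothedMin c 2 (uniformVec n)) := by
  apply excessiveGap_of_smoothedMin hn c two_pos
  have hm := smoothedMin_mem hn c 2 (uniformVec n)
  have h := norm_sub_sq_le_relEntropy hc hm (uniformVec_mem hn) (uniformVec_pos hn)
  have h0 := relEntropy_nonneg hm (uniformVec_mem hn) (uniformVec_pos hn)
  rw [norm_sub_sq_real, real_inner_comm] at h
  linarith

/-- Here `a`, `b`, `e`, `f` stand for the images of `w`, `x` and the old and new smoothed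
minimizers. With `m = (1-θ)b + θe` the new points are `(1-θ)a + θm` and `m + θ(f-e)`. The surplus
`(1-θ)μK` dominates `θ²‖f-e‖²/2` by `hμ`; what remains is half the sum of `(1-θ)θ‖a-m‖²` and
`(1-θ)θ²‖b-e‖²`. -/
theorem excessive_gap_step_inner (a b e f : E) {θ μ D D₀ K : ℝ} (hθ0 : 0 ≤ θ) (hθ1 : θ ≤ 1)
    (hμ : θ ^ 2 ≤ (1 - θ) * μ) (hμ0 : 0 ≤ μ)
    (h1 : inner ℝ a f + μ * D = inner ℝ a e + μ * D₀ + μ * K)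
    (h2 : ‖b‖ ^ 2 / 2 ≤ -(‖a‖ ^ 2 / 2) + inner ℝ a e + μ * D₀)
    (h3 : ‖f - e‖ ^ 2 ≤ 2 * K) :
    ‖(1 - θ) • b + θ • f‖ ^ 2 / 2 ≤
      -(‖(1 - θ) • (a + θ • b) + θ ^ 2 • e‖ ^ 2 / 2) +
        inner ℝ ((1 - θ) • (a + θ • b) + θ ^ 2 • e) f + (1 - θ) * μ * D := by
  have i1 : 0 ≤ (1 - θ) * (-(‖a‖ ^ 2 / 2) + inner ℝ a e + μ * D₀ - ‖b‖ ^ 2 / 2) :=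
    mul_nonneg (by linarith) (by linarith)
  have i2 : 0 ≤ (1 - θ) * μ * (2 * K - ‖f - e‖ ^ 2) :=
    mul_nonneg (mul_nonneg (by linarith) hμ0) (by linarith)
  have i3 : 0 ≤ ((1 - θ) * μ - θ ^ 2) * ‖f - e‖ ^ 2 :=
    mul_nonneg (by linarith) (by positivity)
  have i4 : 0 ≤ (1 - θ) * θ * ‖a - (1 - θ) • b - θ • e‖ ^ 2 :=
    mul_nonneg (mul_nonneg (by linarith) hθ0) (by positivity)
  have i5 : 0 ≤ (1 - θ) * θ ^ 2 * ‖b - e‖ ^ 2 :=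
    mul_nonneg (mul_nonneg (by linarith) (by positivity)) (by positivity)
  have h1' : (1 - θ) * (inner ℝ a f + μ * D) = (1 - θ) * (inner ℝ a e + μ * D₀ + μ * K) := by
    rw [h1]
  simp only [← real_inner_self_eq_norm_sq, inner_add_left, inner_add_right, inner_sub_left,
    inner_sub_right, real_inner_smul_left, real_inner_smul_right, real_inner_comm b a,
    real_inner_comm e a, real_inner_comm f a, real_inner_comm e b, real_inner_comm f b,
    real_inner_comm f e] at *
  linarith

theorem excessiveGap_step (hn : 0 < n) {c : Fin n → E} (hc : ∀ j, ‖c j‖ ≤ 1) {θ μ : ℝ}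
    (hθ0 : 0 ≤ θ) (hθ1 : θ < 1) (hμ0 : 0 < μ) (hμ : θ ^ 2 ≤ (1 - θ) * μ) {w x w' : Vec n}
    (hw' : w' = (1 - θ) • (w + θ • x) + θ ^ 2 • smoothedMin c μ w)
    (hgap : ExcessiveGap c μ w x) :
    ExcessiveGap c ((1 - θ) * μ) w'
      ((1 - θ) • x + θ • smoothedMin c ((1 - θ) * μ) w') := by
  apply excessiveGap_of_smoothedMin hn c (mul_pos (by linarith) hμ0)
  have hp := smoothedMin_mem hn c μ w
  have hp' := smoothedMin_mem hn c ((1 - θ) * μ) w'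
  have h := excessive_gap_step_inner _ _ _ _ hθ0 hθ1.le hμ hμ0.le
    (smoothedMin_identity hn c hμ0 w hp') (hgap _ hp)
    (norm_sub_sq_le_relEntropy hc hp' hp (smoothedMin_pos hn c μ w))
  have e1 : Fintype.linearCombination ℝ c w' =
      (1 - θ) • (Fintype.linearCombination ℝ c w + θ • Fintype.linearCombination ℝ c x) +
        θ ^ 2 • Fintype.linearCombination ℝ c (smoothedMin c μ w) := by
    rw [hw']; simp only [map_add, map_smul]
  rw [← e1] at h
  simpa only [map_add, map_smul] using h

/-- Test the gap with the vertex `e_j`: the scalar product is nonpositive and the entropy at most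
`log n`. -/
theorem ExcessiveGap.norm_sq_le (hn : 0 < n) {c : Fin n → E} {μ : ℝ} (hμ : 0 < μ) {w x : Vec n}
    (hgap : ExcessiveGap c μ w x) {j : Fin n}
    (hj : inner ℝ (c j) (Fintype.linearCombination ℝ c w) ≤ 0) :
    ‖Fintype.linearCombination ℝ c x‖ ^ 2 ≤ 2 * μ * Real.log n := by
  have hu := single_mem_stdSimplex ℝ j
  have h := hgap _ hu
  have h2 := relEntropy_uniformVec_le hn hu
  rw [Fintype.linearCombination_apply_single, one_smul, real_inner_comm] at h
  nlinarith [sq_nonneg ‖Fintype.linearCombination ℝ c w‖]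

/-! ### Mirror Prox -/

/-- The projection of a vector to the unit ball. -/
noncomputable def ballProj (y : E) : E := (max 1 ‖y‖)⁻¹ • y

theorem norm_ballProj_le (y : E) : ‖ballProj y‖ ≤ 1 := by
  have h : 0 < max 1 ‖y‖ := lt_of_lt_of_le one_pos (le_max_left _ _)
  rw [ballProj, norm_smul, norm_inv, Real.norm_of_nonneg h.le, inv_mul_le_iff₀ h, mul_one]
  exact le_max_right _ _

/-- The obtuse angle property of a projection. Outside the ball, `y - ballProj y` is a nonnegative
multiple of the unit vector `ballProj y`, and Cauchy–Schwarz applies. -/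
theorem inner_sub_ballProj_le (y : E) {u : E} (hu : ‖u‖ ≤ 1) :
    inner ℝ (y - ballProj y) (u - ballProj y) ≤ 0 := by
  rcases le_total ‖y‖ 1 with h | h
  · simp [ballProj, max_eq_left h]
  · have hr : 0 < ‖y‖ := by linarith
    have hy : ‖ballProj y‖ = 1 := by
      rw [ballProj, max_eq_right h, norm_smul, norm_inv, norm_norm, inv_mul_cancel₀ hr.ne']
    have h1 : y - ballProj y = (‖y‖ - 1) • ballProj y := by
      rw [sub_smul, one_smul]
      congr 1
      rw [ballProj, max_eq_right h, smul_smul, mul_inv_cancel₀ hr.ne', one_smul]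
    rw [h1, real_inner_smul_left, inner_sub_right, real_inner_self_eq_norm_sq, hy]
    have h2 := real_inner_le_norm (ballProj y) u
    rw [hy] at h2
    nlinarith

theorem ballProj_prox {σ : ℝ} (hσ : 0 < σ) (y b : E) {u : E} (hu : ‖u‖ ≤ 1) :
    inner ℝ b (u - ballProj (y + σ⁻¹ • b)) ≤
      σ / 2 * ‖u - y‖ ^ 2 - σ / 2 * ‖u - ballProj (y + σ⁻¹ • b)‖ ^ 2 -
        σ / 2 * ‖ballProj (y + σ⁻¹ • b) - y‖ ^ 2 := by
  set p := ballProj (y + σ⁻¹ • b) with hp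
  have h := mul_le_mul_of_nonneg_left (inner_sub_ballProj_le (y + σ⁻¹ • b) hu) hσ.le
  rw [← hp, mul_zero] at h
  have e : σ * (σ⁻¹ * inner ℝ b (u - p)) = inner ℝ b (u - p) := by
    rw [← mul_assoc, mul_inv_cancel₀ hσ.ne', one_mul]
  rw [add_sub_right_comm, inner_add_left, real_inner_smul_left, mul_add, e] at h
  have h2 : σ * inner ℝ (y - p) (u - p) = -(σ / 2 * ‖u - y‖ ^ 2 - σ / 2 * ‖u - p‖ ^ 2 -
        σ / 2 * ‖p - y‖ ^ 2) := by
    simp only [← real_inner_self_eq_norm_sq, inner_sub_left, inner_sub_right,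
      real_inner_comm p u, real_inner_comm y u, real_inner_comm p y]
    ring
  linarith

/-- The entropic prox-step from `x` along the gradient at `y`. -/
noncomputable def simplexProx (c : Fin n → E) (σ : ℝ) (x : Vec n) (y : E) : Vec n :=
  gibbs x fun j => σ * inner ℝ (c j) y

theorem simplexProx_identity (hn : 0 < n) (c : Fin n → E) {σ : ℝ} (hσ : 0 < σ) {x : Vec n}
    (hx : ∀ j, 0 < x j) (y : E) {u : Vec n} (hu : u ∈ stdSimplex ℝ (Fin n)) :
    inner ℝ y (Fintype.linearCombination ℝ c (simplexProx c σ x y) -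
        Fintype.linearCombination ℝ c u) =
      σ⁻¹ * relEntropy u x - σ⁻¹ * relEntropy u (simplexProx c σ x y) -
        σ⁻¹ * relEntropy (simplexProx c σ x y) x := by
  have h := relEntropy_gibbs hn hx (fun j => σ * inner ℝ (c j) y) hu
  rw [← simplexProx] at h
  simp only [mul_left_comm _ σ, ← Finset.mul_sum, sum_mul_inner] at h
  rw [inner_sub_right]
  field_simp
  linarith

/-- Young's inequality with weight `σ`, which matches the step sizes of the two prox-steps so that
the cross terms are absorbed exactly. -/
theorem mirrorProx_cross_le {σ : ℝ} (hσ : 0 < σ) (a b : E) {A B : ℝ} (ha : ‖a‖ ^ 2 ≤ A)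
    (hb : ‖b‖ ^ 2 ≤ 2 * B) : inner ℝ a b ≤ σ / 2 * A + σ⁻¹ * B := by
  have h := real_inner_le_norm a b
  have h1 : ‖a‖ * ‖b‖ ≤ σ / 2 * ‖a‖ ^ 2 + σ⁻¹ / 2 * ‖b‖ ^ 2 := by
    have := sq_nonneg (σ * ‖a‖ - ‖b‖)
    have h2 : σ / 2 * ‖a‖ ^ 2 + σ⁻¹ / 2 * ‖b‖ ^ 2 - ‖a‖ * ‖b‖ =
      σ⁻¹ / 2 * (σ * ‖a‖ - ‖b‖) ^ 2 := by field_simp; ring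
    have h3 : 0 ≤ σ⁻¹ / 2 * (σ * ‖a‖ - ‖b‖) ^ 2 := by positivity
    linarith
  have h4 : σ / 2 * ‖a‖ ^ 2 ≤ σ / 2 * A := by gcongr
  have h5 : σ⁻¹ / 2 * ‖b‖ ^ 2 ≤ σ⁻¹ / 2 * (2 * B) := by gcongr
  linarith

/-- One iteration of Mirror Prox does not increase the regret plus the distance to a
comparison point. -/
theorem mirrorProx_step (hn : 0 < n) {c : Fin n → E} (hc : ∀ j, ‖c j‖ ≤ 1) {σ : ℝ} (hσ : 0 < σ)
    {x : Vec n} (hxm : x ∈ stdSimplex ℝ (Fin n)) (hx : ∀ j, 0 < x j) (y : E)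
    {xw xz : Vec n} {yw yz : E}
    (hxw : xw = simplexProx c σ x y)
    (hyw : yw = ballProj (y + σ⁻¹ • Fintype.linearCombination ℝ c x))
    (hxz : xz = simplexProx c σ x yw)
    (hyz : yz = ballProj (y + σ⁻¹ • Fintype.linearCombination ℝ c xw))
    {u : Vec n} (hu : u ∈ stdSimplex ℝ (Fin n)) {v : E} (hv : ‖v‖ ≤ 1) :
    inner ℝ (Fintype.linearCombination ℝ c xw) v - inner ℝ yw (Fintype.linearCombination ℝ c u) +
        (σ⁻¹ * relEntropy u xz + σ / 2 * ‖v - yz‖ ^ 2) ≤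
      σ⁻¹ * relEntropy u x + σ / 2 * ‖v - y‖ ^ 2 := by
  have hxwp : ∀ j, 0 < xw j := hxw ▸ gibbs_pos hn hx _
  have hxwm : xw ∈ stdSimplex ℝ (Fin n) := hxw ▸ gibbs_mem hn hx _
  have hxzp : ∀ j, 0 < xz j := hxz ▸ gibbs_pos hn hx _
  have hxzm : xz ∈ stdSimplex ℝ (Fin n) := hxz ▸ gibbs_mem hn hx _
  have hyz1 : ‖yz‖ ≤ 1 := hyz ▸ norm_ballProj_le _
  -- The extrapolation steps are tested at the next iterates `xz`, `yz`; the actual steps at the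
  -- comparison points `u`, `v`.
  have p1 := simplexProx_identity hn c hσ hx y hxzm
  have p2 := simplexProx_identity hn c hσ hx yw hu
  have p3 := ballProj_prox hσ y (Fintype.linearCombination ℝ c x) hyz1
  have p4 := ballProj_prox hσ y (Fintype.linearCombination ℝ c xw) hv
  rw [← hxw] at p1
  rw [← hxz] at p2
  rw [← hyw] at p3
  rw [← hyz] at p4
  have q1 := norm_sub_sq_le_relEntropy hc hxwm hxm hx
  have q2 := norm_sub_sq_le_relEntropy hc hxzm hxwm hxwp
  -- The sum of the four relations leaves the errors of using old gradients, and these two bounds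
  -- consume precisely the negative distance terms not involving `u` or `v`.
  have c1 := mirrorProx_cross_le hσ (yw - y) _ le_rfl (by rw [norm_sub_rev]; exact q2)
  have c2 := mirrorProx_cross_le hσ (yz - yw) _ le_rfl q1
  simp only [inner_sub_left, inner_sub_right,
    real_inner_comm yz, real_inner_comm yw, real_inner_comm v] at *
  linarith

/-- The bound on the regret of Mirror Prox against all comparison points, for the current point
`(x, y)` and the sum `(xs, ys)` of the intermediate points. -/
def RegretBound (c : Fin n → E) (σ : ℝ) (x : Vec n) (y : E) (xs : Vec n) (ys : E) : Prop :=
  ∀ u ∈ stdSimplex ℝ (Fin n), ∀ v : E, ‖v‖ ≤ 1 →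
    inner ℝ (Fintype.linearCombination ℝ c xs) v - inner ℝ ys (Fintype.linearCombination ℝ c u) +
      (σ⁻¹ * relEntropy u x + σ / 2 * ‖v - y‖ ^ 2) ≤ σ

/-- The initial distance is at most `σ⁻¹ log n + σ/2`, and the choice of `σ` makes both parts at
most `σ/2`. -/
theorem regretBound_init (hn : 0 < n) (c : Fin n → E) {σ : ℝ} (hσ : 0 < σ)
    (hσn : 2 * Real.log n ≤ σ ^ 2) : RegretBound c σ (uniformVec n) 0 0 0 := by
  intro u hu v hv
  have h := relEntropy_uniformVec_le hn hu
  have h1 : σ⁻¹ * relEntropy u (uniformVec n) ≤ σ / 2 := by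
    rw [inv_mul_le_iff₀ hσ]; nlinarith
  have h2 : ‖v‖ ^ 2 ≤ 1 := pow_le_one₀ (norm_nonneg _) hv
  simp only [map_zero, inner_zero_left, sub_zero]
  nlinarith

theorem RegretBound.step (hn : 0 < n) {c : Fin n → E} (hc : ∀ j, ‖c j‖ ≤ 1) {σ : ℝ}
    (hσ : 0 < σ) {x : Vec n} (hxm : x ∈ stdSimplex ℝ (Fin n)) (hx : ∀ j, 0 < x j) {y : E}
    {xs : Vec n} {ys : E} (h : RegretBound c σ x y xs ys)
    {xw xz : Vec n} {yw yz : E}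
    (hxw : xw = simplexProx c σ x y)
    (hyw : yw = ballProj (y + σ⁻¹ • Fintype.linearCombination ℝ c x))
    (hxz : xz = simplexProx c σ x yw)
    (hyz : yz = ballProj (y + σ⁻¹ • Fintype.linearCombination ℝ c xw)) :
    RegretBound c σ xz yz (xs + xw) (ys + yw) := by
  intro u hu v hv
  have h1 := h u hu v hv
  have h2 := mirrorProx_step hn hc hσ hxm hx y hxw hyw hxz hyz hu hv
  rw [map_add, inner_add_left, inner_add_left]
  linarith

/-- Compare with `u = e_j` and with `v` the unit vector in the direction of the accumulated image:
the regret is then at least its norm. -/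
theorem RegretBound.norm_le {c : Fin n → E} {σ : ℝ} (hσ : 0 < σ) {x : Vec n} {y : E}
    {xs : Vec n} {ys : E} (hxm : x ∈ stdSimplex ℝ (Fin n)) (hx : ∀ j, 0 < x j)
    (h : RegretBound c σ x y xs ys) {j : Fin n} (hj : inner ℝ (c j) ys ≤ 0) :
    ‖Fintype.linearCombination ℝ c xs‖ ≤ σ := by
  set b := Fintype.linearCombination ℝ c xs with hb
  rcases eq_or_ne b 0 with h0 | h0
  · rw [h0, norm_zero]; exact hσ.le
  have hb0 : 0 < ‖b‖ := norm_pos_iff.2 h0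
  have hu := single_mem_stdSimplex ℝ j
  have hv : ‖‖b‖⁻¹ • b‖ ≤ 1 := by
    rw [norm_smul, norm_inv, norm_norm, inv_mul_cancel₀ hb0.ne']
  have h1 := h _ hu _ hv
  rw [← hb, Fintype.linearCombination_apply_single, one_smul, real_inner_smul_right,
    real_inner_self_eq_norm_sq, real_inner_comm,
    show ‖b‖⁻¹ * ‖b‖ ^ 2 = ‖b‖ by field_simp] at h1
  have h2 := relEntropy_nonneg hu hxm hx
  have h3 : 0 ≤ σ⁻¹ * relEntropy (Pi.single j 1) x := by positivity
  have h4 : 0 ≤ σ / 2 * ‖‖b‖⁻¹ • b - y‖ ^ 2 := by positivity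
  linarith

end FirstOrderAnalysis

end ImageRescaling

namespace ImageRescaling

/-! ### Values and costs of the elementary computations -/

namespace Counted

theorem ops_bind {α β : Type} (p : Counted α) (f : α → Counted β) :
    (p >>= f).ops = p.ops + (f p.val).ops := rfl

theorem iters_bind {α β : Type} (p : Counted α) (f : α → Counted β) :
    (p >>= f).iters = p.iters + (f p.val).iters := rfl

theorem val_pure {α : Type} (a : α) : (pure a : Counted α).val = a := rfl

theorem ops_pure {α : Type} (a : α) : (pure a : Counted α).ops = 0 := rfl

theorem iters_pure {α : Type} (a : α) : (pure a : Counted α).iters = 0 := rfl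

variable {m n : ℕ}

theorem dot_ops (u v : Vec n) : (dot u v).ops = 2 * n := by
  simp [dot, sum, mul]; ring

theorem dot_iters (u v : Vec n) : (dot u v).iters = 0 := by simp [dot, sum, mul]

theorem mulVec_val (M : Mat m n) (v : Vec n) : (mulVec M v).val = M *ᵥ v := rfl

theorem mulVec_ops (M : Mat m n) (v : Vec n) : (mulVec M v).ops = 2 * (m * n) := by
  simp [mulVec, tabulate, dot_ops]; ring

theorem mulVec_iters (M : Mat m n) (v : Vec n) : (mulVec M v).iters = 0 := by
  simp [mulVec, tabulate, dot_iters]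

theorem sqNorm_ops (Q : Mat m m) (v : Vec m) : (sqNorm Q v).ops = 2 * (m * m) + 2 * m := by
  simp [sqNorm, ops_bind, mulVec_ops, dot_ops]

theorem sqNorm_iters (Q : Mat m m) (v : Vec m) : (sqNorm Q v).iters = 0 := by
  simp [sqNorm, iters_bind, mulVec_iters, dot_iters]

theorem qNorm_val (Q : Mat m m) (v : Vec m) : (qNorm Q v).val = √(v ⬝ᵥ (Q *ᵥ v)) := rfl

theorem qNorm_ops (Q : Mat m m) (v : Vec m) : (qNorm Q v).ops = 2 * (m * m) + 2 * m + 1 := by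
  simp [qNorm, ops_bind, sqNorm_ops, sqrt]

theorem qNorm_iters (Q : Mat m m) (v : Vec m) : (qNorm Q v).iters = 0 := by
  simp [qNorm, iters_bind, sqNorm_iters, sqrt]

theorem allPos_val_iff (v : Vec n) : (allPos v).val = true ↔ ∀ j, 0 < v j := by
  classical exact decide_eq_true_iff

theorem allPos_ops (v : Vec n) : (allPos v).ops = n := rfl

theorem allPos_iters (v : Vec n) : (allPos v).iters = 0 := rfl

theorem le_val_iff (x y : ℝ) : (le x y).val = true ↔ x ≤ y := by
  classical exact decide_eq_true_iff

theorem le_ops (x y : ℝ) : (le x y).ops = 1 := rfl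

theorem le_iters (x y : ℝ) : (le x y).iters = 0 := rfl

theorem inverseStep_ops (R Q : Mat m m) (k : Fin m) :
    (inverseStep R Q k).ops = 5 * (m * m) + m + 1 := by
  simp [inverseStep, ops_bind, mulVec_ops, tabulate, matrix, sub, add, mul, div]; ring

theorem inverseStep_iters (R Q : Mat m m) (k : Fin m) : (inverseStep R Q k).iters = 0 := by
  simp [inverseStep, iters_bind, mulVec_iters, tabulate, matrix, sub, add, mul, div]

theorem inverse_ops (R : Mat m m) : (inverse R).ops = m * (5 * (m * m) + m + 1) := by
  have h : ∀ (l : List (Fin m)) (Q : Mat m m),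
      (l.foldlM (inverseStep R) Q).ops = l.length * (5 * (m * m) + m + 1) := by
    intro l
    induction l with
    | nil => intro Q; simp [ops_pure]
    | cons k l ih => intro Q; rw [List.foldlM_cons, ops_bind, ih, inverseStep_ops,
        List.length_cons]; ring
  have h1 := h (List.finRange m) 1
  rwa [List.length_finRange] at h1

theorem inverse_iters (R : Mat m m) : (inverse R).iters = 0 := by
  have h : ∀ (l : List (Fin m)) (Q : Mat m m), (l.foldlM (inverseStep R) Q).iters = 0 := by
    intro l
    induction l with
    | nil => intro Q; simp [iters_pure]
    | cons k l ih => intro Q; rw [List.foldlM_cons, iters_bind, ih, inverseStep_iters]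
  exact h (List.finRange m) 1

/-- A loop with an invariant that fails after `K` passes is left within `K` passes. -/
theorem loop_spec {σ τ : Type} (body : σ → Counted (σ ⊕ τ)) (I : ℕ → σ → Prop) (P : τ → Prop)
    (c d K : ℕ)
    (h : ∀ k s, I k s → (body s).ops ≤ c ∧ (body s).iters ≤ d ∧
      (body s).val.elim (fun s' => I (k + 1) s') P)
    (hK : ∀ s, ¬ I K s) :
    ∀ N k s, I k s → k ≤ K → K ≤ N + k → ∃ r, (loop body N s).val = some r ∧ P r ∧
      (loop body N s).ops ≤ (K - k) * c ∧ (loop body N s).iters ≤ (K - k) * d := by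
  intro N
  induction N with
  | zero =>
    intro k s hI hk hN
    obtain rfl : k = K := by omega
    exact absurd hI (hK s)
  | succ N ih =>
    intro k s hI hk hN
    have hkK : k < K := lt_of_le_of_ne hk fun e => hK s (e ▸ hI)
    obtain ⟨h1, h2, h3⟩ := h k s hI
    have e : K - k = (K - (k + 1)) + 1 := by omega
    rw [loop, val_bind, ops_bind, iters_bind]
    rcases hv : (body s).val with s' | r
    · rw [hv] at h3
      obtain ⟨r, hr, hP, ho, hi⟩ := ih (k + 1) s' h3 hkK (by omega)
      refine ⟨r, hr, hP, ?_, ?_⟩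
      · rw [e, add_mul, one_mul, add_comm]; exact Nat.add_le_add ho h1
      · rw [e, add_mul, one_mul, add_comm]; exact Nat.add_le_add hi h2
    · rw [hv] at h3
      refine ⟨r, rfl, h3, ?_, ?_⟩
      · rw [e, add_mul, one_mul]; simp only [ops_pure]; omega
      · rw [e, add_mul, one_mul]; simp only [iters_pure]; omega

end Counted

open Counted hiding max

variable {m n : ℕ}

theorem scores_val (B : Mat m n) (Q : Mat m m) (y : Vec m) :
    (scores B Q y).val = Bᵀ *ᵥ (Q *ᵥ y) := rfl

theorem scores_ops (B : Mat m n) (Q : Mat m m) (y : Vec m) :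
    (scores B Q y).ops = 2 * (m * m) + 2 * (n * m) := by
  simp [scores, ops_bind, mulVec_ops]

theorem scores_iters (B : Mat m n) (Q : Mat m m) (y : Vec m) : (scores B Q y).iters = 0 := by
  simp [scores, iters_bind, mulVec_iters]

theorem toSimplex_val (e : Vec n) : (toSimplex e).val = fun j => e j / ∑ i, e i := rfl

theorem toSimplex_ops (e : Vec n) : (toSimplex e).ops = 2 * n := by
  simp [toSimplex, ops_bind, ops_pure, Counted.sum, tabulate, div]; ring

theorem toSimplex_iters (e : Vec n) : (toSimplex e).iters = 0 := by
  simp [toSimplex, iters_bind, iters_pure, Counted.sum, tabulate, div]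

theorem softMin_val (hn : 0 < n) (g : Vec n) (μ : ℝ) :
    (softMin g μ).val = gibbs (uniformVec n) fun j => g j / μ := by
  have h : (softMin g μ).val = fun j => Real.exp (0 - g j / μ) / ∑ i, Real.exp (0 - g i / μ) :=
    rfl
  have hn' : (n : ℝ) ≠ 0 := by positivity
  rw [h]
  funext j
  simp only [gibbs, uniformVec, zero_sub, ← Finset.mul_sum]
  rw [mul_div_mul_left _ _ (by positivity)]

theorem softMin_ops (g : Vec n) (μ : ℝ) : (softMin g μ).ops = 5 * n := by
  simp [softMin, ops_bind, toSimplex_ops, tabulate, div, sub, exp]; ring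

theorem softMin_iters (g : Vec n) (μ : ℝ) : (softMin g μ).iters = 0 := by
  simp [softMin, iters_bind, toSimplex_iters, tabulate, div, sub, exp]

theorem normalizeColumns_val (A : Mat m n) (Q : Mat m m) :
    (normalizeColumns A Q).val = Matrix.of fun i j => A i j / √(A.col j ⬝ᵥ (Q *ᵥ A.col j)) := rfl

theorem normalizeColumns_ops (A : Mat m n) (Q : Mat m m) :
    (normalizeColumns A Q).ops = n * (2 * (m * m) + 2 * m + 1) + m * n := by
  simp [normalizeColumns, ops_bind, qNorm_ops, tabulate, matrix, div]

theorem normalizeColumns_iters (A : Mat m n) (Q : Mat m m) :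
    (normalizeColumns A Q).iters = 0 := by
  simp [normalizeColumns, iters_bind, qNorm_iters, tabulate, matrix, div]

/-! ### Guarantees of the first order methods -/

/-- The vectors `c_j` of a Euclidean space have the scalar products `b_iᵀ Q b_j`. -/
structure Represents {E : Type*} [NormedAddCommGroup E] [InnerProductSpace ℝ E] (B : Mat m n)
    (Q : Mat m m) (c : Fin n → E) : Prop where
  scores_eq : ∀ v, Bᵀ *ᵥ (Q *ᵥ (B *ᵥ v)) =
    fun j => inner ℝ (c j) (Fintype.linearCombination ℝ c v)
  norm_eq : ∀ v, √((B *ᵥ v) ⬝ᵥ (Q *ᵥ (B *ᵥ v))) = ‖Fintype.linearCombination ℝ c v‖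

open scoped MatrixOrder Matrix.Norms.L2Operator in
theorem exists_eq_transpose_mul_self {Q : Mat m m} (hQ : Q.PosSemidef) :
    ∃ S : Mat m m, Q = Sᵀ * S := by
  obtain ⟨S, hS⟩ := CStarAlgebra.nonneg_iff_eq_star_mul_self.mp hQ.nonneg
  refine ⟨S, ?_⟩
  rwa [Matrix.star_eq_conjTranspose, Matrix.conjTranspose_eq_transpose_of_trivial] at hS

/-- Take `c_j = S b_j` for a factorization `Q = Sᵀ S`. This transfers the analysis in an inner
product space to the matrix computations in the scalar product of `Q`. -/
theorem exists_represents (B : Mat m n) {Q : Mat m m} (hQ : Q.PosSemidef) :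
    ∃ c : Fin n → EuclideanSpace ℝ (Fin m), Represents B Q c ∧
      ∀ j, ‖c j‖ = √(B.col j ⬝ᵥ (Q *ᵥ B.col j)) := by
  obtain ⟨S, hS⟩ := exists_eq_transpose_mul_self hQ
  set c : Fin n → EuclideanSpace ℝ (Fin m) := fun j => WithLp.toLp 2 (S *ᵥ B.col j) with hc
  have hlin : ∀ v, Fintype.linearCombination ℝ c v = WithLp.toLp 2 (S *ᵥ (B *ᵥ v)) := by
    intro v
    rw [Fintype.linearCombination_apply]
    ext i
    simp only [hc, Matrix.mulVec_mulVec, WithLp.ofLp_sum, Finset.sum_apply, PiLp.smul_apply,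
      smul_eq_mul]
    simp only [Matrix.mulVec, dotProduct, Matrix.mul_apply, Matrix.col_apply, Finset.mul_sum,
      Finset.sum_mul]
    exact Finset.sum_congr rfl fun j _ => Finset.sum_congr rfl fun k _ => by ring
  have hin : ∀ a b : Vec m, inner ℝ (WithLp.toLp 2 (S *ᵥ a)) (WithLp.toLp 2 (S *ᵥ b)) =
      a ⬝ᵥ (Q *ᵥ b) := by
    intro a b
    rw [EuclideanSpace.inner_toLp_toLp, star_trivial, hS, ← Matrix.mulVec_mulVec,
      Matrix.dotProduct_mulVec a, Matrix.vecMul_transpose, dotProduct_comm]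
  have hnorm : ∀ a : Vec m, ‖(WithLp.toLp 2 (S *ᵥ a) : EuclideanSpace ℝ (Fin m))‖ =
      √(a ⬝ᵥ (Q *ᵥ a)) := fun a => by
    rw [← hin, real_inner_self_eq_norm_sq, Real.sqrt_sq (norm_nonneg _)]
  refine ⟨c, ⟨fun v => ?_, fun v => ?_⟩, fun j => hnorm _⟩
  · funext j
    rw [hlin, hc, hin]
    rfl
  · rw [hlin, hnorm]

/-- The outcome `(x, y)` of the first order method: `Bᵀ Q y > 0`, or `x` is a convex combination
with `y = B x` and `‖y‖_Q ≤ ε`. -/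
def IsOutcome (B : Mat m n) (Q : Mat m m) (ε : ℝ) (r : Vec n × Vec m) : Prop :=
  (∀ j, 0 < (Bᵀ *ᵥ (Q *ᵥ r.2)) j) ∨
    (r.1 ∈ stdSimplex ℝ (Fin n) ∧ r.2 = B *ᵥ r.1 ∧ √(r.2 ⬝ᵥ (Q *ᵥ r.2)) ≤ ε)

variable {E : Type*} [NormedAddCommGroup E] [InnerProductSpace ℝ E]

/-! #### The Smoothed Perceptron -/

/-- The invariant of the Smoothed Perceptron after `i` iterations. -/
structure SPInv (c : Fin n → E) (K i : ℕ) (s : SPState n) : Prop where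
  k_eq : s.k = i
  μ_eq : s.μ = 4 / ((i + 1) * (i + 2))
  mem : s.x ∈ stdSimplex ℝ (Fin n)
  gap : ExcessiveGap c s.μ s.w s.x
  le : i ≤ K

theorem spInit_val (hn : 0 < n) {B : Mat m n} {Q : Mat m m} {c : Fin n → E}
    (hB : Represents B Q c) :
    (spInit B Q).val = ⟨0, 2, uniformVec n, smoothedMin c 2 (uniformVec n)⟩ := by
  have h : (spInit B Q).val = ⟨0, 2, uniformVec n,
    (softMin (Bᵀ *ᵥ (Q *ᵥ (B *ᵥ uniformVec n))) 2).val⟩ := rfl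
  rw [h, softMin_val hn, hB.scores_eq]
  rfl

theorem spInit_ops (B : Mat m n) (Q : Mat m m) :
    (spInit B Q).ops = 2 * (m * m) + 4 * (m * n) + 6 * n := by
  simp [spInit, ops_bind, ops_pure, tabulate, div, scores_ops, mulVec_ops, softMin_ops]; ring

theorem spInit_iters (B : Mat m n) (Q : Mat m m) : (spInit B Q).iters = 0 := by
  simp [spInit, iters_bind, iters_pure, tabulate, div, scores_iters, mulVec_iters, softMin_iters]

theorem spInit_inv (hn : 0 < n) {B : Mat m n} {Q : Mat m m} {c : Fin n → E}
    (hB : Represents B Q c) (hc : ∀ j, ‖c j‖ ≤ 1) (K : ℕ) : SPInv c K 0 (spInit B Q).val := by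
  rw [spInit_val hn hB]
  exact ⟨by simp, by norm_num, smoothedMin_mem hn _ _ _, excessiveGap_init hn hc, Nat.zero_le _⟩

theorem spUpdate_ops (B : Mat m n) (Q : Mat m m) (s : SPState n) (g : Vec n) :
    (spUpdate B Q s g).ops = 2 * (m * m) + 4 * (m * n) + 18 * n + 6 := by
  simp [spUpdate, ops_bind, ops_pure, iteration, tabulate, div, mul, add, sub, scores_ops,
    mulVec_ops, softMin_ops]
  ring

theorem spUpdate_iters (B : Mat m n) (Q : Mat m m) (s : SPState n) (g : Vec n) :
    (spUpdate B Q s g).iters = 1 := by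
  simp [spUpdate, iters_bind, iters_pure, iteration, tabulate, div, mul, add, sub, scores_iters,
    mulVec_iters, softMin_iters]

theorem spUpdate_inv (hn : 0 < n) {B : Mat m n} {Q : Mat m m} {c : Fin n → E}
    (hB : Represents B Q c) (hc : ∀ j, ‖c j‖ ≤ 1) {K i : ℕ} {s : SPState n}
    (hs : SPInv c K i s) (hi : i + 1 ≤ K) :
    SPInv c K (i + 1) (spUpdate B Q s (Bᵀ *ᵥ (Q *ᵥ (B *ᵥ s.w)))).val := by
  set θ : ℝ := 2 / (s.k + 3) with hθ
  have hθ' : θ = 2 / (i + 3) := by rw [hθ, hs.k_eq]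
  set w' : Vec n := (1 - θ) • (s.w + θ • s.x) + θ ^ 2 • smoothedMin c s.μ s.w with hw'
  have hsm : ∀ (μ : ℝ) (w : Vec n),
      (softMin (Bᵀ *ᵥ (Q *ᵥ (B *ᵥ w))) μ).val = smoothedMin c μ w := by
    intro μ w
    rw [softMin_val hn, hB.scores_eq]
    rfl
  have h0 : (spUpdate B Q s (Bᵀ *ᵥ (Q *ᵥ (B *ᵥ s.w)))).val = ⟨s.k + 1, (1 - θ) * s.μ, w',
      (1 - θ) • s.x + θ • smoothedMin c ((1 - θ) * s.μ) w'⟩ := by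
    rw [← hsm]
    have : w' = fun j => (1 - θ) * (s.w j + θ * s.x j) +
        θ * θ * (softMin (Bᵀ *ᵥ (Q *ᵥ (B *ᵥ s.w))) s.μ).val j := by
      rw [hsm, ← pow_two]; rfl
    rw [this]
    rfl
  have hi0 : (0 : ℝ) ≤ i := Nat.cast_nonneg i
  have hθ0 : 0 ≤ θ := by rw [hθ']; positivity
  have hθ1 : θ < 1 := by rw [hθ', div_lt_one (by positivity)]; linarith
  -- The factor is `1 - θ = (i+1)/(i+3)`, so the products telescope.
  have hμ : (1 - θ) * s.μ = 4 / ((i + 2) * (i + 3)) := by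
    rw [hs.μ_eq, hθ']; field_simp; ring
  have hμ0 : 0 < s.μ := by rw [hs.μ_eq]; positivity
  rw [h0]
  refine ⟨by simp [hs.k_eq], ?_, ?_, ?_, hi⟩
  · rw [hμ]; push_cast; ring_nf
  · exact (convex_stdSimplex ℝ (Fin n)) hs.mem (smoothedMin_mem hn _ _ _) (by linarith) hθ0
      (by ring)
  · refine excessiveGap_step hn hc hθ0 hθ1 hμ0 ?_ hw' hs.gap
    rw [hμ, hθ', div_pow, show (2 : ℝ) ^ 2 = 4 by norm_num]
    apply div_le_div_of_nonneg_left (by norm_num) (by positivity)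
    nlinarith

theorem spBody_spec (hn : 0 < n) {B : Mat m n} {Q : Mat m m} {c : Fin n → E}
    (hB : Represents B Q c) (hc : ∀ j, ‖c j‖ ≤ 1) {ε : ℝ} (hε : 0 < ε) {K : ℕ}
    (hK : 3 * √(Real.log (n + 1)) ≤ ε * K) (i : ℕ) (s : SPState n) (hs : SPInv c K i s) :
    (spBody B Q ε s).ops ≤ 6 * (m * m) + 10 * (m * n) + 2 * m + 20 * n + 8 ∧
    (spBody B Q ε s).iters ≤ 1 ∧
    (spBody B Q ε s).val.elim (fun s' => SPInv c K (i + 1) s') (IsOutcome B Q ε) := by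
  simp only [spBody, val_bind, ops_bind, iters_bind, mulVec_val, mulVec_ops, mulVec_iters,
    scores_val, scores_ops, scores_iters, allPos_val_iff, allPos_ops, allPos_iters]
  split_ifs with h1
  · refine ⟨?_, ?_, ?_⟩
    · simp only [ops_pure, mul_comm n m]; omega
    · simp [iters_pure]
    · exact Or.inl h1
  · simp only [val_bind, ops_bind, iters_bind, mulVec_val, mulVec_ops, mulVec_iters, qNorm_val,
      qNorm_ops, qNorm_iters, le_val_iff, le_ops, le_iters]
    split_ifs with h2
    · refine ⟨?_, ?_, ?_⟩
      · simp only [ops_pure, mul_comm n m]; omega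
      · simp [iters_pure]
      · exact Or.inr ⟨hs.mem, rfl, h2⟩
    · simp only [val_bind, ops_bind, iters_bind, val_pure, ops_pure, iters_pure, spUpdate_ops,
        spUpdate_iters, mul_comm n m]
      refine ⟨by omega, by omega, spUpdate_inv hn hB hc hs ?_⟩
      push Not at h1
      obtain ⟨j, hj⟩ := h1
      rw [hB.scores_eq] at hj
      have hi0 : (0 : ℝ) ≤ i := Nat.cast_nonneg i
      have hμ0 : 0 < s.μ := by rw [hs.μ_eq]; positivity
      have h3 := hs.gap.norm_sq_le hn hμ0 hj
      rw [hB.norm_eq, not_le] at h2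
      -- If `i ≥ K`, the gap gives `ε² (i+1)(i+2) < 8 log n`, contradicting `(εK)² ≥ 9 log (n+1)`.
      by_contra hcon
      have hKi : (K : ℝ) ≤ i := by exact_mod_cast (by omega : K ≤ i)
      have hn1 : (1 : ℝ) ≤ n := by exact_mod_cast hn
      have hl0 : 0 ≤ Real.log n := Real.log_nonneg hn1
      have hl : Real.log n ≤ Real.log (n + 1) :=
        Real.log_le_log (by linarith) (by linarith)
      have h4 : 9 * Real.log (n + 1) ≤ (ε * K) ^ 2 := by
        calc 9 * Real.log (n + 1) = (3 * √(Real.log (n + 1))) ^ 2 := by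
              rw [mul_pow, Real.sq_sqrt (hl0.trans hl)]; norm_num
          _ ≤ _ := by gcongr
      have h5 : ε ^ 2 < ‖Fintype.linearCombination ℝ c s.x‖ ^ 2 := by gcongr
      have h6 : ε ^ 2 * ((i + 1) * (i + 2)) < 8 * Real.log n := by
        have := h5.trans_le h3
        rw [hs.μ_eq, show 2 * (4 / ((i + 1 : ℝ) * (i + 2))) * Real.log n =
          8 * Real.log n / ((i + 1) * (i + 2)) by ring, lt_div_iff₀ (by positivity)] at this
        exact this
      have h7 : (ε * K) ^ 2 ≤ ε ^ 2 * ((i + 1) * (i + 2)) := by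
        rw [mul_pow]
        gcongr
        have : (0 : ℝ) ≤ K := Nat.cast_nonneg K
        nlinarith
      linarith

theorem smoothedPerceptron_spec (hn : 0 < n) {B : Mat m n} {Q : Mat m m} {c : Fin n → E}
    (hB : Represents B Q c) (hc : ∀ j, ‖c j‖ ≤ 1) {ε : ℝ} (hε : 0 < ε) {K : ℕ}
    (hK : 3 * √(Real.log (n + 1)) ≤ ε * K) {N : ℕ} (hN : K + 1 ≤ N) :
    ∃ r, (smoothedPerceptron N B Q ε).val = some r ∧ IsOutcome B Q ε r ∧
      (smoothedPerceptron N B Q ε).ops ≤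
        (K + 2) * (6 * (m * m) + 10 * (m * n) + 2 * m + 20 * n + 8) ∧
      (smoothedPerceptron N B Q ε).iters ≤ K + 1 := by
  -- The state after `K` iterations still has to be examined, hence `K + 1` passes; the invariant `i
  -- ≤ K` fails at `K + 1`.
  obtain ⟨r, hr, hP, ho, hi⟩ := loop_spec (spBody B Q ε) (SPInv c K) (IsOutcome B Q ε) _ 1 (K + 1)
    (spBody_spec hn hB hc hε hK) (fun s hs => by have := hs.le; omega) N 0 _
    (spInit_inv hn hB hc K) (by omega) (by omega)
  refine ⟨r, hr, hP, ?_, ?_⟩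
  · rw [smoothedPerceptron, ops_bind, spInit_ops]
    have e : ∀ X : ℕ, (K + 2) * X = X + (K + 1 - 0) * X := fun X => by rw [Nat.sub_zero]; ring
    rw [e]
    refine Nat.add_le_add ?_ ho
    omega
  · rw [smoothedPerceptron, iters_bind, spInit_iters]
    omega

/-! #### Mirror Prox -/

theorem mpProx_val (B : Mat m n) (Q : Mat m m) {c : Fin n → E}
    (hB : Represents B Q c) (σ : ℝ) (x v x₀ v₀ : Vec n) :
    (mpProx B Q σ x v x₀ v₀).val =
      (simplexProx c σ x (Fintype.linearCombination ℝ c v₀),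
        (max 1 ‖Fintype.linearCombination ℝ c v + σ⁻¹ • Fintype.linearCombination ℝ c x₀‖)⁻¹ •
          (v + σ⁻¹ • x₀)) := by
  have h : (mpProx B Q σ x v x₀ v₀).val =
      ((fun j => x j * Real.exp (0 - σ * (Bᵀ *ᵥ (Q *ᵥ (B *ᵥ v₀))) j) /
          ∑ i, x i * Real.exp (0 - σ * (Bᵀ *ᵥ (Q *ᵥ (B *ᵥ v₀))) i)),
        fun j => (v j + x₀ j / σ) / max 1 √((B *ᵥ fun j => v j + x₀ j / σ) ⬝ᵥ
          (Q *ᵥ (B *ᵥ fun j => v j + x₀ j / σ)))) := rfl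
  have hu : (fun j => v j + x₀ j / σ) = v + σ⁻¹ • x₀ := by
    funext j; simp [div_eq_inv_mul]
  rw [h, hu, hB.norm_eq, hB.scores_eq, map_add, map_smul]
  refine Prod.ext ?_ ?_
  · funext j; simp only [simplexProx, gibbs, zero_sub]
  · funext j; simp only [Pi.smul_apply, Pi.add_apply, smul_eq_mul]; ring

theorem mpProx_ops (B : Mat m n) (Q : Mat m m) (σ : ℝ) (x v x₀ v₀ : Vec n) :
    (mpProx B Q σ x v x₀ v₀).ops = 4 * (m * m) + 6 * (m * n) + 2 * m + 9 * n + 2 := by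
  simp [mpProx, ops_bind, ops_pure, tabulate, mul, exp, sub, add, div, Counted.max, scores_ops,
    mulVec_ops, toSimplex_ops, qNorm_ops]
  ring

theorem mpProx_iters (B : Mat m n) (Q : Mat m m) (σ : ℝ) (x v x₀ v₀ : Vec n) :
    (mpProx B Q σ x v x₀ v₀).iters = 0 := by
  simp [mpProx, iters_bind, iters_pure, tabulate, mul, exp, sub, add, div, Counted.max,
    scores_iters, mulVec_iters, toSimplex_iters, qNorm_iters]

/-- The invariant of Mirror Prox after `i` iterations. -/
structure MPInv (c : Fin n → E) (σ : ℝ) (K i : ℕ) (s : MPState n) : Prop where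
  t_eq : s.t = i
  mem : s.x ∈ stdSimplex ℝ (Fin n)
  pos : ∀ j, 0 < s.x j
  v_nonneg : ∀ j, 0 ≤ s.v j
  vSum_nonneg : ∀ j, 0 ≤ s.vSum j
  xSum_nonneg : ∀ j, 0 ≤ s.xSum j
  sum_xSum : ∑ j, s.xSum j = i
  regret : RegretBound c σ s.x (Fintype.linearCombination ℝ c s.v) s.xSum
    (Fintype.linearCombination ℝ c s.vSum)
  le : i ≤ K

/-- The state after a Mirror Prox iteration that does not end the loop. -/
noncomputable def mpNext (c : Fin n → E) (σ : ℝ) (s : MPState n) : MPState n :=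
  let y := Fintype.linearCombination ℝ c s.v
  let xw := simplexProx c σ s.x y
  let vw := (max 1 ‖y + σ⁻¹ • Fintype.linearCombination ℝ c s.x‖)⁻¹ • (s.v + σ⁻¹ • s.x)
  ⟨s.t + 1, simplexProx c σ s.x (Fintype.linearCombination ℝ c vw),
    (max 1 ‖y + σ⁻¹ • Fintype.linearCombination ℝ c xw‖)⁻¹ • (s.v + σ⁻¹ • xw),
    s.xSum + xw, s.vSum + vw⟩

theorem linearCombination_ballProj (c : Fin n → E) (v x : Vec n) (σ : ℝ) :
    Fintype.linearCombination ℝ c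
      ((max 1 ‖Fintype.linearCombination ℝ c v + σ⁻¹ • Fintype.linearCombination ℝ c x‖)⁻¹ •
        (v + σ⁻¹ • x)) =
      ballProj (Fintype.linearCombination ℝ c v + σ⁻¹ • Fintype.linearCombination ℝ c x) := by
  rw [ballProj, map_smul, map_add, map_smul]

/-- The bound `K'` is independent of `K`: the value `i + 1` gives the regret bound at the next state
unconditionally; once that bound has shown `i + 1 ≤ K`, the lemma is applied again with `K`. -/
theorem mpNext_inv (hn : 0 < n) {c : Fin n → E} (hc : ∀ j, ‖c j‖ ≤ 1) {σ : ℝ} (hσ : 0 < σ)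
    {K i : ℕ} {s : MPState n} (hs : MPInv c σ K i s) {K' : ℕ} (hi : i + 1 ≤ K') :
    MPInv c σ K' (i + 1) (mpNext c σ s) := by
  have hproj : ∀ (a : ℝ) (x : Vec n), (∀ j, 0 ≤ x j) → ∀ j,
      0 ≤ ((max 1 a)⁻¹ • (s.v + σ⁻¹ • x)) j := by
    intro a x hx j
    have := hs.v_nonneg j
    have := hx j
    simp only [Pi.smul_apply, Pi.add_apply, smul_eq_mul]
    have : 0 ≤ max 1 a := le_trans zero_le_one (le_max_left _ _)
    positivity
  have hxw := gibbs_mem hn hs.pos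
    (fun j => σ * inner ℝ (c j) (Fintype.linearCombination ℝ c s.v))
  rw [← simplexProx] at hxw
  refine ⟨?_, gibbs_mem hn hs.pos _, gibbs_pos hn hs.pos _, hproj _ _ hxw.1, fun j =>
    add_nonneg (hs.vSum_nonneg j) (hproj _ _ hs.mem.1 j),
    fun j => add_nonneg (hs.xSum_nonneg j) (hxw.1 j), ?_, ?_, hi⟩
  · simp [mpNext, hs.t_eq]
  · simp only [mpNext, Pi.add_apply, Finset.sum_add_distrib, hs.sum_xSum, hxw.2]
    push_cast; rfl
  · simp only [mpNext]
    rw [map_add, linearCombination_ballProj, linearCombination_ballProj]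
    exact hs.regret.step hn hc hσ hs.mem hs.pos rfl rfl rfl rfl

theorem mpBody_spec (hn : 0 < n) {B : Mat m n} {Q : Mat m m} {c : Fin n → E}
    (hB : Represents B Q c) (hc : ∀ j, ‖c j‖ ≤ 1) {ε σ : ℝ} (hσ : 0 < σ) (hε : 0 < ε) {K : ℕ}
    (hK : σ ≤ ε * K) (i : ℕ) (s : MPState n) (hs : MPInv c σ K i s) :
    (mpBody B Q ε σ s).ops ≤ 12 * (m * m) + 20 * (m * n) + 6 * m + 25 * n + 8 ∧
    (mpBody B Q ε σ s).iters ≤ 1 ∧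
    (mpBody B Q ε σ s).val.elim (fun s' => MPInv c σ K (i + 1) s') (IsOutcome B Q ε) := by
  set s' := mpNext c σ s with hs'
  have hinv : MPInv c σ (i + 1) (i + 1) s' := mpNext_inv hn hc hσ hs le_rfl
  have ht : s'.t = i + 1 := by rw [hinv.t_eq]; push_cast; rfl
  have ht0 : 0 < s'.t := by rw [ht]; positivity
  have hval : (mpBody B Q ε σ s).val = if ∀ j, 0 < (Bᵀ *ᵥ (Q *ᵥ (B *ᵥ (s'.t⁻¹ • s'.vSum)))) j
      then .inr ((fun j => (s'.t⁻¹ • s'.vSum) j / ∑ l, (s'.t⁻¹ • s'.vSum) l),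
        B *ᵥ (fun j => (s'.t⁻¹ • s'.vSum) j / ∑ l, (s'.t⁻¹ • s'.vSum) l))
      else if √((B *ᵥ (s'.t⁻¹ • s'.xSum)) ⬝ᵥ (Q *ᵥ (B *ᵥ (s'.t⁻¹ • s'.xSum)))) ≤ ε then
        .inr (s'.t⁻¹ • s'.xSum, B *ᵥ (s'.t⁻¹ • s'.xSum)) else .inl s' := by
    have e1 : ∀ (v : Vec n) (t : ℝ), (fun j => v j / t) = t⁻¹ • v := fun v t => by
      funext j; simp [div_eq_inv_mul]
    have e2 : ∀ a b : Vec n, (fun j => a j + b j) = a + b := fun _ _ => rfl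
    simp only [mpBody, val_bind, mpProx_val B Q hB, tabulate, add, div, allPos_val_iff, scores_val,
      mulVec_val, e1, e2]
    simp only [hs', mpNext]
    split_ifs with h1 h2
    · simp only [val_bind, toSimplex_val, mulVec_val, val_pure, e1]
    all_goals
      simp only [val_bind, mulVec_val, qNorm_val, le_val_iff]
    · rw [if_pos (by assumption)]
      rfl
    · rw [if_neg (by assumption)]
      rfl
  refine ⟨?_, ?_, ?_⟩
  · simp only [mpBody, ops_bind, mpProx_ops, iteration, tabulate, add, div, scores_ops,
      mulVec_ops, allPos_ops, Finset.sum_const, Finset.card_univ, Fintype.card_fin, smul_eq_mul,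
      mul_one]
    split_ifs
    · simp only [ops_bind, toSimplex_ops, mulVec_ops, ops_pure, mul_comm n m]; omega
    · simp only [ops_bind, qNorm_ops, mulVec_ops, le_ops, mul_comm n m]
      split_ifs
      · simp only [ops_pure]; omega
      · simp only [ops_pure]; omega
  · simp only [mpBody, iters_bind, mpProx_iters, iteration, tabulate, add, div,
      scores_iters, mulVec_iters, allPos_iters, Finset.sum_const_zero]
    split_ifs
    · simp [iters_bind, toSimplex_iters, mulVec_iters, iters_pure]
    · simp only [iters_bind, qNorm_iters, mulVec_iters, le_iters]
      split_ifs
      · simp [iters_pure]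
      · simp [iters_pure]
  · rw [hval]
    split_ifs with h1 h2
    · left
      have hnn : ∀ j, 0 ≤ (s'.t⁻¹ • s'.vSum) j := fun j =>
        mul_nonneg (inv_nonneg.2 ht0.le) (hinv.vSum_nonneg j)
      set v := s'.t⁻¹ • s'.vSum with hv
      -- The sum cannot vanish: otherwise `v = 0` and all scores would be zero. Normalization thus
      -- preserves positivity of the scores.
      have hsum : 0 < ∑ l, v l := by
        refine lt_of_le_of_ne (Finset.sum_nonneg fun l _ => hnn l) fun h0 => ?_
        have hv0 : v = 0 := by
          funext l
          exact (Finset.sum_eq_zero_iff_of_nonneg fun l _ => hnn l).1 h0.symm l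
            (Finset.mem_univ l)
        have := h1 ⟨0, hn⟩
        rw [hv0] at this
        simp at this
      have e : (fun j => v j / ∑ l, v l) = (∑ l, v l)⁻¹ • v := by
        funext j; simp [div_eq_inv_mul]
      intro j
      simp only [e, Matrix.mulVec_smul, Pi.smul_apply, smul_eq_mul]
      exact mul_pos (inv_pos.2 hsum) (h1 j)
    · refine Or.inr ⟨⟨fun j => mul_nonneg (inv_nonneg.2 ht0.le) (hinv.xSum_nonneg j), ?_⟩, rfl, h2⟩
      simp only [Pi.smul_apply, smul_eq_mul, ← Finset.mul_sum, hinv.sum_xSum]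
      rw [hinv.t_eq, inv_mul_cancel₀]
      positivity
    · refine mpNext_inv hn hc hσ hs ?_
      push Not at h1
      obtain ⟨j, hj⟩ := h1
      rw [hB.scores_eq] at hj
      rw [hB.norm_eq, not_le, map_smul, norm_smul, norm_inv, Real.norm_of_nonneg ht0.le,
        lt_inv_mul_iff₀ ht0] at h2
      simp only [map_smul, real_inner_smul_right] at hj
      have hj' : inner ℝ (c j) (Fintype.linearCombination ℝ c s'.vSum) ≤ 0 := by
        by_contra hcon
        push Not at hcon
        have := mul_pos (inv_pos.2 ht0) hcon
        linarith
      -- The accumulated image has norm at most `σ ≤ εK`, but the failed test says that it exceeds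
      -- `εt`; so `t < K`.
      have h3 := hinv.regret.norm_le hσ hinv.mem hinv.pos hj'
      have h4 : s'.t * ε < K * ε := by linarith
      have h5 : s'.t < K := lt_of_mul_lt_mul_right h4 hε.le
      rw [hinv.t_eq] at h5
      exact_mod_cast h5.le

theorem mirrorProx_ops (N : ℕ) (B : Mat m n) (Q : Mat m m) (ε : ℝ) :
    (mirrorProx N B Q ε).ops = 4 + n +
      (loop (mpBody B Q ε √(2 * Real.log (n + 1))) N ⟨0, uniformVec n, 0, 0, 0⟩).ops := by
  have h : (mirrorProx N B Q ε).ops = 1 + (1 + (1 + (1 + (∑ _i : Fin n, 1 +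
      (loop (mpBody B Q ε √(2 * Real.log (n + 1))) N ⟨0, uniformVec n, 0, 0, 0⟩).ops)))) := rfl
  rw [h]
  simp only [Finset.sum_const, Finset.card_univ, Fintype.card_fin, smul_eq_mul, mul_one]
  ring

theorem mirrorProx_iters (N : ℕ) (B : Mat m n) (Q : Mat m m) (ε : ℝ) :
    (mirrorProx N B Q ε).iters =
      (loop (mpBody B Q ε √(2 * Real.log (n + 1))) N ⟨0, uniformVec n, 0, 0, 0⟩).iters := by
  have h : (mirrorProx N B Q ε).iters = 0 + (0 + (0 + (0 + (∑ _i : Fin n, 0 +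
      (loop (mpBody B Q ε √(2 * Real.log (n + 1))) N ⟨0, uniformVec n, 0, 0, 0⟩).iters)))) := rfl
  rw [h]
  simp only [Finset.sum_const_zero, zero_add]

theorem mirrorProx_spec (hn : 0 < n) {B : Mat m n} {Q : Mat m m} {c : Fin n → E}
    (hB : Represents B Q c) (hc : ∀ j, ‖c j‖ ≤ 1) {ε : ℝ} (hε : 0 < ε) {K : ℕ}
    (hK : 3 * √(Real.log (n + 1)) ≤ ε * K) {N : ℕ} (hN : K + 1 ≤ N) :
    ∃ r, (mirrorProx N B Q ε).val = some r ∧ IsOutcome B Q ε r ∧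
      (mirrorProx N B Q ε).ops ≤
        (K + 2) * (12 * (m * m) + 20 * (m * n) + 6 * m + 25 * n + 8) ∧
      (mirrorProx N B Q ε).iters ≤ K + 1 := by
  set σ := √(2 * Real.log (n + 1)) with hσd
  have hn1 : (1 : ℝ) ≤ n := by exact_mod_cast hn
  have hl0 : 0 < Real.log (n + 1) := Real.log_pos (by linarith)
  have hσ : 0 < σ := Real.sqrt_pos.2 (by positivity)
  have hσK : σ ≤ ε * K := by
    refine le_trans ?_ hK
    rw [hσd, Real.sqrt_le_left (by positivity), mul_pow, Real.sq_sqrt hl0.le]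
    linarith
  have hσn : 2 * Real.log n ≤ σ ^ 2 := by
    rw [hσd, Real.sq_sqrt (by positivity)]
    have : Real.log n ≤ Real.log (n + 1) := Real.log_le_log (by linarith) (by linarith)
    linarith
  have h0 : MPInv c σ K 0 ⟨0, uniformVec n, 0, 0, 0⟩ :=
    ⟨by simp, uniformVec_mem hn, uniformVec_pos hn, fun _ => le_rfl, fun _ => le_rfl,
      fun _ => le_rfl, by simp, by simpa using regretBound_init hn c hσ hσn, Nat.zero_le _⟩
  obtain ⟨r, hr, hP, ho, hi⟩ := loop_spec (mpBody B Q ε σ) (MPInv c σ K) (IsOutcome B Q ε) _ 1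
    (K + 1) (mpBody_spec hn hB hc hσ hε hσK) (fun s hs => by have := hs.le; omega) N 0 _ h0
    (by omega) (by omega)
  have hops := mirrorProx_ops N B Q ε
  rw [← hσd] at hops
  have hiters := mirrorProx_iters N B Q ε
  rw [← hσd] at hiters
  refine ⟨r, hr, hP, ?_, ?_⟩
  · rw [hops]
    have e : ∀ X : ℕ, (K + 2) * X = X + (K + 1 - 0) * X := fun X => by rw [Nat.sub_zero]; ring
    rw [e]
    refine Nat.add_le_add ?_ ho
    omega
  · rw [hiters]
    omega

end ImageRescaling

namespace ImageRescaling

open Counted hiding max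

variable {m n : ℕ}

/-! ### Determinants of positive definite matrices -/

theorem exists_eigenvalue_eq {H : Mat m m} (hH : H.IsHermitian) (i : Fin m) :
    ∃ v : Vec m, v ⬝ᵥ v = 1 ∧ v ⬝ᵥ (H *ᵥ v) = hH.eigenvalues i := by
  have h1 : ((hH.eigenvectorBasis i : EuclideanSpace ℝ (Fin m)) : Vec m) ⬝ᵥ
      (hH.eigenvectorBasis i : EuclideanSpace ℝ (Fin m)) = 1 := by
    have h := hH.eigenvectorBasis.orthonormal.1 i
    have h2 := real_inner_self_eq_norm_sq (hH.eigenvectorBasis i)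
    rw [h, EuclideanSpace.inner_eq_star_dotProduct, star_trivial] at h2
    simpa using h2
  refine ⟨_, h1, ?_⟩
  rw [hH.mulVec_eigenvectorBasis i, dotProduct_smul, h1, smul_eq_mul, mul_one]

theorem det_le_pow {R : Mat m m} (hR : R.PosSemidef) {c : ℝ}
    (h : ∀ u : Vec m, u ⬝ᵥ u = 1 → u ⬝ᵥ (R *ᵥ u) ≤ c) : R.det ≤ c ^ m := by
  rw [hR.isHermitian.det_eq_prod_eigenvalues]
  refine (Finset.prod_le_prod (fun i _ => hR.eigenvalues_nonneg i) (g := fun _ => c)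
    fun i _ => ?_).trans (by simp)
  obtain ⟨v, hv, hv2⟩ := exists_eigenvalue_eq hR.isHermitian i
  have := h v hv
  rw [hv2] at this
  exact this

theorem one_add_sum_sub_le_prod {ι : Type*} (s : Finset ι) (f : ι → ℝ) (hf : ∀ i, 1 ≤ f i) :
    1 + ∑ i ∈ s, (f i - 1) ≤ ∏ i ∈ s, f i := by
  classical
  induction s using Finset.induction_on with
  | empty => simp
  | insert a s ha ih =>
    rw [Finset.sum_insert ha, Finset.prod_insert ha]
    have h1 := hf a
    have h2 : 0 ≤ ∑ i ∈ s, (f i - 1) := Finset.sum_nonneg fun i _ => by linarith [hf i]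
    nlinarith

/-- All eigenvalues of `1 + M` are at least `1`, and expanding their product gives at least `1` plus
the sum of the excesses. -/
theorem one_add_trace_le_det {M : Mat m m} (hM : M.PosSemidef) :
    1 + M.trace ≤ (1 + M).det := by
  have hH : (1 + M).IsHermitian := Matrix.isHermitian_one.add hM.isHermitian
  have h1 : ∀ i, 1 ≤ hH.eigenvalues i := by
    intro i
    obtain ⟨v, hv, hv2⟩ := exists_eigenvalue_eq hH i
    rw [← hv2, Matrix.add_mulVec, Matrix.one_mulVec, dotProduct_add, hv]
    have := hM.dotProduct_mulVec_nonneg v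
    rw [star_trivial] at this
    linarith
  have h2 := hH.trace_eq_sum_eigenvalues
  have h3 := hH.det_eq_prod_eigenvalues
  simp only [RCLike.ofReal_real_eq_id, id_eq] at h2 h3
  have h4 := one_add_sum_sub_le_prod Finset.univ _ h1
  rw [Finset.sum_sub_distrib, ← h2, Matrix.trace_add, Matrix.trace_one] at h4
  rw [h3]
  refine le_trans (le_of_eq ?_) h4
  simp

/-- With `R = Sᵀ S`, congruence by `S⁻¹` reduces to the case `R = 1`. -/
theorem det_mul_one_add_trace_le {R M : Mat m m} (hR : R.PosDef) (hM : M.PosSemidef) :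
    R.det * (1 + (M * R⁻¹).trace) ≤ (R + M).det := by
  obtain ⟨S, hS⟩ := exists_eq_transpose_mul_self hR.posSemidef
  have hdet : R.det = S.det * S.det := by rw [hS, Matrix.det_mul, Matrix.det_transpose]
  have hS0 : IsUnit S.det := by
    have := hR.det_pos.ne'
    rw [hdet] at this
    exact (left_ne_zero_of_mul this).isUnit
  have hST : IsUnit Sᵀ.det := by rwa [Matrix.det_transpose]
  set N := (S⁻¹)ᵀ * M * S⁻¹ with hN
  have hNpsd : N.PosSemidef := by
    have := hM.conjTranspose_mul_mul_same S⁻¹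
    rwa [Matrix.conjTranspose_eq_transpose_of_trivial] at this
  have h1 : R + M = Sᵀ * (1 + N) * S := by
    rw [Matrix.mul_add, Matrix.add_mul, Matrix.mul_one, ← hS, hN, Matrix.transpose_nonsing_inv]
    congr 1
    rw [Matrix.mul_assoc Sᵀ⁻¹, Matrix.mul_nonsing_inv_cancel_left _ _ hST, Matrix.mul_assoc,
      Matrix.nonsing_inv_mul _ hS0, Matrix.mul_one]
  have h2 : N.trace = (M * R⁻¹).trace := by
    rw [hN, Matrix.mul_assoc, Matrix.trace_mul_comm, hS, Matrix.mul_inv_rev,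
      Matrix.transpose_nonsing_inv, Matrix.mul_assoc]
  rw [h1, Matrix.det_mul, Matrix.det_mul, Matrix.det_transpose, ← h2, hdet]
  have := mul_le_mul_of_nonneg_left (one_add_trace_le_det hNpsd) (mul_self_nonneg S.det)
  linarith

/-- Cauchy–Schwarz in the scalar product of `R`, applied to `R⁻¹ a` and `z`. -/
theorem dotProduct_sq_le {R : Mat m m} (hR : R.PosDef) (a z : Vec m) :
    (a ⬝ᵥ z) ^ 2 ≤ (a ⬝ᵥ (R⁻¹ *ᵥ a)) * (z ⬝ᵥ (R *ᵥ z)) := by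
  obtain ⟨S, hS⟩ := exists_eq_transpose_mul_self hR.posSemidef
  have hu : IsUnit R.det := hR.det_pos.ne'.isUnit
  set w := R⁻¹ *ᵥ a with hw
  have ha : a = R *ᵥ w := by rw [hw, Matrix.mulVec_mulVec, Matrix.mul_nonsing_inv _ hu,
    Matrix.one_mulVec]
  have h : ∀ u v : Vec m, (R *ᵥ u) ⬝ᵥ v = (S *ᵥ u) ⬝ᵥ (S *ᵥ v) := by
    intro u v
    rw [hS, ← Matrix.mulVec_mulVec, Matrix.mulVec_transpose, ← Matrix.dotProduct_mulVec]
  rw [dotProduct_comm z, h z z, ha, h, h]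
  have := Finset.sum_mul_sq_le_sq_mul_sq Finset.univ (S *ᵥ w) (S *ᵥ z)
  simpa only [dotProduct, pow_two] using this

theorem dotProduct_le_sqrt_mul_sqrt {R : Mat m m} (hR : R.PosDef) (a z : Vec m) :
    a ⬝ᵥ z ≤ √(a ⬝ᵥ (R⁻¹ *ᵥ a)) * √(z ⬝ᵥ (R *ᵥ z)) := by
  have h1 := hR.inv.posSemidef.dotProduct_mulVec_nonneg a
  rw [star_trivial] at h1
  rw [← Real.sqrt_mul h1]
  exact Real.le_sqrt_of_sq_le (dotProduct_sq_le hR a z)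

/-! ### Calls of the first order method -/

theorem sqNorm_pos {Q : Mat m m} (hQ : Q.PosDef) {v : Vec m} (hv : v ≠ 0) :
    0 < v ⬝ᵥ (Q *ᵥ v) := by
  simpa using hQ.dotProduct_mulVec_pos hv

theorem normalizeColumns_col (A : Mat m n) (Q : Mat m m) (j : Fin n) :
    (normalizeColumns A Q).val.col j = (√(A.col j ⬝ᵥ (Q *ᵥ A.col j)))⁻¹ • A.col j := by
  funext i
  rw [normalizeColumns_val]
  simp [div_eq_inv_mul]

theorem normalizeColumns_sqNorm {A : Mat m n} {Q : Mat m m} (hQ : Q.PosDef) {j : Fin n}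
    (hj : A.col j ≠ 0) :
    (normalizeColumns A Q).val.col j ⬝ᵥ (Q *ᵥ (normalizeColumns A Q).val.col j) = 1 := by
  have h := sqNorm_pos hQ hj
  rw [normalizeColumns_col, Matrix.mulVec_smul, smul_dotProduct, dotProduct_smul, smul_eq_mul,
    smul_eq_mul]
  have h2 := Real.sqrt_pos.2 h
  field_simp
  exact (Real.sq_sqrt h.le).symm

theorem call_spec (method : FirstOrderMethod) (hn : 0 < n) {A : Mat m n}
    (hA : ∀ j, A.col j ≠ 0) {Q : Mat m m} (hQ : Q.PosDef) {ε : ℝ} (hε : 0 < ε) {K : ℕ}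
    (hK : 3 * √(Real.log (n + 1)) ≤ ε * K) {N : ℕ} (hN : K + 1 ≤ N) :
    ∃ r, (method.call N A Q ε).val = some r ∧ IsOutcome (normalizeColumns A Q).val Q ε r ∧
      (method.call N A Q ε).ops ≤ n * (2 * (m * m) + 2 * m + 1) + m * n +
        (K + 2) * (12 * (m * m) + 20 * (m * n) + 6 * m + 25 * n + 8) ∧
      (method.call N A Q ε).iters ≤ K + 1 := by
  obtain ⟨c, hB, hc⟩ := exists_represents (normalizeColumns A Q).val hQ.posSemidef
  have hc1 : ∀ j, ‖c j‖ ≤ 1 := fun j => by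
    rw [hc, normalizeColumns_sqNorm hQ (hA j), Real.sqrt_one]
  cases method with
  | smoothedPerceptron =>
    obtain ⟨r, h1, h2, h3, h4⟩ := smoothedPerceptron_spec hn hB hc1 hε hK hN
    refine ⟨r, h1, h2, ?_, ?_⟩
    · change (normalizeColumns A Q).ops + _ ≤ _
      rw [normalizeColumns_ops]
      refine Nat.add_le_add_left (h3.trans (Nat.mul_le_mul_left _ ?_)) _
      omega
    · change (normalizeColumns A Q).iters + _ ≤ _
      rwa [normalizeColumns_iters, zero_add]
  | mirrorProx =>
    obtain ⟨r, h1, h2, h3, h4⟩ := mirrorProx_spec hn hB hc1 hε hK hN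
    refine ⟨r, h1, h2, ?_, ?_⟩
    · change (normalizeColumns A Q).ops + _ ≤ _
      rw [normalizeColumns_ops]
      exact Nat.add_le_add_left h3 _
    · change (normalizeColumns A Q).iters + _ ≤ _
      rwa [normalizeColumns_iters, zero_add]

/-! ### Rescaling -/

/-- The rescaled matrix, for the matrix `B` of normalized columns. -/
noncomputable def rescaled (B : Mat m n) (ε : ℝ) (R : Mat m m) (x : Vec n) : Mat m m :=
  (1 + ε)⁻¹ • (R + B * Matrix.diagonal x * Bᵀ)

theorem mul_diagonal_mul_transpose_apply (B : Mat m n) (x : Vec n) (i j : Fin m) :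
    (B * Matrix.diagonal x * Bᵀ) i j = ∑ l, x l * (B i l * B j l) := by
  rw [Matrix.mul_apply]
  refine Finset.sum_congr rfl fun l _ => ?_
  rw [Matrix.mul_diagonal, Matrix.transpose_apply]
  ring

theorem dotProduct_mul_diagonal_mul_transpose (B : Mat m n) (x : Vec n) (z : Vec m) :
    z ⬝ᵥ ((B * Matrix.diagonal x * Bᵀ) *ᵥ z) = ∑ l, x l * (B.col l ⬝ᵥ z) ^ 2 := by
  rw [← Matrix.mulVec_mulVec, ← Matrix.mulVec_mulVec, Matrix.dotProduct_mulVec]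
  refine Finset.sum_congr rfl fun l _ => ?_
  rw [Matrix.mulVec_diagonal, Matrix.mulVec_transpose,
    show (z ᵥ* B) l = B.col l ⬝ᵥ z from dotProduct_comm _ _]
  ring

theorem posSemidef_mul_diagonal_mul_transpose (B : Mat m n) {x : Vec n} (hx : ∀ j, 0 ≤ x j) :
    (B * Matrix.diagonal x * Bᵀ).PosSemidef := by
  have h := (Matrix.PosSemidef.diagonal (d := x) hx).mul_mul_conjTranspose_same B
  rwa [Matrix.conjTranspose_eq_transpose_of_trivial] at h

theorem trace_mul_diagonal_mul_transpose (B : Mat m n) (Q : Mat m m) (x : Vec n) :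
    (B * Matrix.diagonal x * Bᵀ * Q).trace = ∑ l, x l * (B.col l ⬝ᵥ (Q *ᵥ B.col l)) := by
  rw [Matrix.mul_assoc, Matrix.trace_mul_comm, ← Matrix.mul_assoc, Matrix.trace]
  refine Finset.sum_congr rfl fun l _ => ?_
  rw [Matrix.diag_apply, Matrix.mul_diagonal, mul_comm, Matrix.mul_assoc]
  rfl

theorem rescaled_posDef (B : Mat m n) {ε : ℝ} (hε : 0 < ε) {R : Mat m m} (hR : R.PosDef)
    {x : Vec n} (hx : ∀ j, 0 ≤ x j) : (rescaled B ε R x).PosDef :=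
  (hR.add_posSemidef (posSemidef_mul_diagonal_mul_transpose B hx)).smul (by positivity)

theorem rescale_val (A : Mat m n) {ε : ℝ} (hε : 0 < ε) {R : Mat m m} (hR : R.PosDef)
    {Q : Mat m m} (hQ : Q.PosDef) {x : Vec n} (hx : ∀ j, 0 ≤ x j) :
    (rescale A ε R Q x).val = (rescaled (normalizeColumns A Q).val ε R x,
      (rescaled (normalizeColumns A Q).val ε R x)⁻¹) := by
  have h : (rescale A ε R Q x).val = (Matrix.of fun i j => (R i j + ∑ l,
      x l / (A.col l ⬝ᵥ (Q *ᵥ A.col l)) * (A i l * A j l)) / (1 + ε),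
      (inverse (Matrix.of fun i j => (R i j + ∑ l,
      x l / (A.col l ⬝ᵥ (Q *ᵥ A.col l)) * (A i l * A j l)) / (1 + ε))).val) := rfl
  have h2 : (Matrix.of fun i j => (R i j + ∑ l,
      x l / (A.col l ⬝ᵥ (Q *ᵥ A.col l)) * (A i l * A j l)) / (1 + ε)) =
      rescaled (normalizeColumns A Q).val ε R x := by
    ext i j
    rw [rescaled, Matrix.smul_apply, Matrix.add_apply, mul_diagonal_mul_transpose_apply,
      Matrix.of_apply, smul_eq_mul, div_eq_inv_mul]
    congr 2
    refine Finset.sum_congr rfl fun l _ => ?_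
    have h3 : 0 ≤ A.col l ⬝ᵥ (Q *ᵥ A.col l) := by
      simpa using hQ.posSemidef.dotProduct_mulVec_nonneg (A.col l)
    rw [normalizeColumns_val, Matrix.of_apply, Matrix.of_apply, div_mul_div_comm,
      Real.mul_self_sqrt h3]
    ring
  rw [h, h2, inverse_val _ (rescaled_posDef _ hε hR hx)]

theorem rescale_ops (A : Mat m n) (ε : ℝ) (R Q : Mat m m) (x : Vec n) :
    (rescale A ε R Q x).ops = n * (2 * (m * m) + 2 * m + 1) + 1 + m * (m * (3 * n + 2)) +
      m * (5 * (m * m) + m + 1) := by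
  simp [rescale, ops_bind, ops_pure, tabulate, matrix, Counted.sum, sqNorm_ops, div, add, mul,
    inverse_ops]
  ring

theorem rescale_iters (A : Mat m n) (ε : ℝ) (R Q : Mat m m) (x : Vec n) :
    (rescale A ε R Q x).iters = 0 := by
  simp [rescale, iters_bind, iters_pure, tabulate, matrix, Counted.sum, sqNorm_iters, div, add,
    mul, inverse_iters]

/-- The relative trace is `∑ x_l ‖b_l‖_Q² = 1`, giving a factor `2`; division by `1 + ε` loses at
most `exp (1/11)`, and `1/2 + 1/11 < log 2`. -/
theorem det_rescaled_ge (hm : 0 < m) (B : Mat m n) {R : Mat m m} (hR : R.PosDef) {x : Vec n}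
    (hx : x ∈ stdSimplex ℝ (Fin n)) (hB : ∀ j, B.col j ⬝ᵥ (R⁻¹ *ᵥ B.col j) = 1) :
    Real.exp (1 / 2) * R.det ≤ (rescaled B (1 / (11 * m)) R x).det := by
  have hm' : (0 : ℝ) < m := by exact_mod_cast hm
  have h1 := det_mul_one_add_trace_le hR (posSemidef_mul_diagonal_mul_transpose B hx.1)
  rw [trace_mul_diagonal_mul_transpose] at h1
  simp only [hB, mul_one, hx.2] at h1
  rw [rescaled, Matrix.det_smul, Fintype.card_fin, inv_pow, ← div_eq_inv_mul,
    le_div_iff₀ (by positivity)]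
  have h2 : (1 + 1 / (11 * (m : ℝ))) ^ m ≤ Real.exp (1 / 11) := by
    calc (1 + 1 / (11 * (m : ℝ))) ^ m ≤ Real.exp (1 / (11 * m)) ^ m := by
          gcongr
          rw [add_comm]
          exact Real.add_one_le_exp _
      _ = Real.exp (1 / 11) := by
          rw [← Real.exp_nat_mul]
          congr 1
          field_simp
  have h3 : Real.exp (1 / 2) * Real.exp (1 / 11) ≤ 2 := by
    rw [← Real.exp_add, ← Real.le_log_iff_exp_le two_pos]
    have := Real.log_two_gt_d9
    linarith
  have h4 : Real.exp (1 / 2) * (1 + 1 / (11 * (m : ℝ))) ^ m ≤ 2 :=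
    (mul_le_mul_of_nonneg_left h2 (Real.exp_pos _).le).trans h3
  have h5 := mul_le_mul_of_nonneg_right h4 hR.det_pos.le
  linarith

/-- For `z` in the cone and `r = ‖z‖_R`, each `b_lᵀ z` lies between `0` and `r`, so the quadratic
sum is at most `r` times the linear one, `(Bx)ᵀ z ≤ ε r`. -/
theorem dotProduct_rescaled_le (B : Mat m n) {ε : ℝ} (hε : 0 < ε) {R : Mat m m} (hR : R.PosDef)
    {x : Vec n} (hx : ∀ j, 0 ≤ x j) (hB : ∀ j, B.col j ⬝ᵥ (R⁻¹ *ᵥ B.col j) = 1)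
    (hy : √((B *ᵥ x) ⬝ᵥ (R⁻¹ *ᵥ (B *ᵥ x))) ≤ ε) {z : Vec m} (hz : ∀ j, 0 ≤ B.col j ⬝ᵥ z) :
    z ⬝ᵥ (rescaled B ε R x *ᵥ z) ≤ z ⬝ᵥ (R *ᵥ z) := by
  have hr : 0 ≤ z ⬝ᵥ (R *ᵥ z) := by simpa using hR.posSemidef.dotProduct_mulVec_nonneg z
  set r := √(z ⬝ᵥ (R *ᵥ z)) with hrd
  have hr2 : r * r = z ⬝ᵥ (R *ᵥ z) := Real.mul_self_sqrt hr
  have h1 : ∀ l, x l * (B.col l ⬝ᵥ z) ^ 2 ≤ r * (x l * (B.col l ⬝ᵥ z)) := by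
    intro l
    have := dotProduct_le_sqrt_mul_sqrt hR (B.col l) z
    rw [hB, Real.sqrt_one, one_mul, ← hrd] at this
    have h2 := mul_nonneg (hx l) (hz l)
    nlinarith
  have h2 : ∑ l, x l * (B.col l ⬝ᵥ z) = (B *ᵥ x) ⬝ᵥ z := by
    rw [dotProduct_comm, Matrix.dotProduct_mulVec]
    refine Finset.sum_congr rfl fun l _ => ?_
    rw [mul_comm, dotProduct_comm]
    rfl
  have h3 := Finset.sum_le_sum fun l (_ : l ∈ Finset.univ) => h1 l
  rw [← Finset.mul_sum, h2] at h3
  have h4 := dotProduct_le_sqrt_mul_sqrt hR (B *ᵥ x) z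
  rw [← hrd] at h4
  have h5 : (B *ᵥ x) ⬝ᵥ z ≤ ε * r := h4.trans (by gcongr)
  have h6 : r * ((B *ᵥ x) ⬝ᵥ z) ≤ r * (ε * r) := by gcongr
  rw [rescaled, Matrix.smul_mulVec, dotProduct_smul, Matrix.add_mulVec, dotProduct_add,
    dotProduct_mul_diagonal_mul_transpose, smul_eq_mul, inv_mul_le_iff₀ (by linarith)]
  nlinarith

/-! ### The main loop -/

/-- The invariant of the main loop after `k` rescalings. -/
structure RescalingInv (A : Mat m n) (k : ℕ) (s : Mat m m × Mat m m) : Prop where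
  posDef : s.1.PosDef
  inv_eq : s.2 = s.1⁻¹
  det_ge : Real.exp (k / 2) ≤ s.1.det
  cone_le : ∀ z : Vec m, (∀ j, 0 ≤ A.col j ⬝ᵥ z) → z ⬝ᵥ (s.1 *ᵥ z) ≤ z ⬝ᵥ z

theorem rescalingInv_one (A : Mat m n) : RescalingInv A 0 (1, 1) :=
  ⟨Matrix.PosDef.one, by simp, by simp, fun z _ => by simp⟩

/-- If the cone `{y | Aᵀ y ≥ 0}` contains a ball of radius `δ` around a unit vector, then the
number of rescalings is bounded. -/
theorem RescalingInv.le {A : Mat m n} {k : ℕ} {s : Mat m m × Mat m m} (hs : RescalingInv A k s)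
    {δ : ℝ} (hδ : 0 < δ) (hδ1 : δ ≤ 1) {y : Vec m} (hy : y ⬝ᵥ y = 1)
    (hA : ∀ j, δ * √(A.col j ⬝ᵥ A.col j) ≤ A.col j ⬝ᵥ y) :
    (k : ℝ) ≤ 2 * m * (Real.log 2 - 2 * Real.log δ) := by
  have hcs : ∀ (j : Fin n) (u : Vec m), u ⬝ᵥ u = 1 → |A.col j ⬝ᵥ u| ≤ √(A.col j ⬝ᵥ A.col j) := by
    intro j u hu
    apply Real.abs_le_sqrt
    have := Finset.sum_mul_sq_le_sq_mul_sq Finset.univ (A.col j) u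
    simp only [dotProduct, ← pow_two] at hu ⊢
    rwa [hu, mul_one] at this
  -- Both `y + δu` and `y - δu` lie in the cone. Adding the two inequalities removes the mixed terms
  -- and leaves `δ² uᵀ R u ≤ 1 + δ² ≤ 2`.
  have hu : ∀ u : Vec m, u ⬝ᵥ u = 1 → u ⬝ᵥ (s.1 *ᵥ u) ≤ 2 / δ ^ 2 := by
    intro u hu
    have hp : ∀ t : ℝ, |t| = δ → (y + t • u) ⬝ᵥ (s.1 *ᵥ (y + t • u)) ≤
        (y + t • u) ⬝ᵥ (y + t • u) := by
      intro t ht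
      refine hs.cone_le _ fun j => ?_
      rw [dotProduct_add, dotProduct_smul, smul_eq_mul]
      have h1 := hA j
      have h2 : |t * (A.col j ⬝ᵥ u)| ≤ δ * √(A.col j ⬝ᵥ A.col j) := by
        rw [abs_mul, ht]; gcongr; exact hcs j u hu
      linarith [neg_abs_le (t * (A.col j ⬝ᵥ u))]
    have h1 := hp δ (abs_of_pos hδ)
    have h2 := hp (-δ) (by rw [abs_neg, abs_of_pos hδ])
    have h0 : 0 ≤ y ⬝ᵥ (s.1 *ᵥ y) := by
      simpa using hs.posDef.posSemidef.dotProduct_mulVec_nonneg y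
    simp only [dotProduct_add, add_dotProduct, Matrix.mulVec_add, Matrix.mulVec_smul,
      dotProduct_smul, smul_dotProduct, smul_eq_mul, hy, hu] at h1 h2
    rw [le_div_iff₀ (by positivity)]
    nlinarith
  have h1 := hs.det_ge.trans (det_le_pow hs.posDef.posSemidef hu)
  rw [← Real.le_log_iff_exp_le (by positivity), Real.log_pow, Real.log_div two_ne_zero
    (by positivity), Real.log_pow] at h1
  push_cast at h1
  linarith

theorem imageBody_spec (method : FirstOrderMethod) (hm : 0 < m) (hn : 0 < n) {A : Mat m n}
    (hA : ∀ j, A.col j ≠ 0) {K : ℕ}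
    (hK : 3 * √(Real.log (n + 1)) ≤ 1 / (11 * (m : ℝ)) * K) {N : ℕ} (hN : K + 1 ≤ N)
    (k : ℕ) (s : Mat m m × Mat m m) (hs : RescalingInv A k s) :
    (imageBody method N A (1 / (11 * m)) s).ops ≤
      (n * (2 * (m * m) + 2 * m + 1) + m * n +
        (K + 2) * (12 * (m * m) + 20 * (m * n) + 6 * m + 25 * n + 8)) +
      (2 * (m * m) + 2 * (m * n) + n + (n * (2 * (m * m) + 2 * m + 1) + 1 +
        m * (m * (3 * n + 2)) + m * (5 * (m * m) + m + 1))) ∧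
    (imageBody method N A (1 / (11 * m)) s).iters ≤ K + 1 ∧
    (imageBody method N A (1 / (11 * m)) s).val.elim (fun s' => RescalingInv A (k + 1) s')
      (fun r => ∃ y, r = some y ∧ ∀ j, 0 < (Aᵀ *ᵥ y) j) := by
  have hm' : (0 : ℝ) < m := by exact_mod_cast hm
  have hε : 0 < 1 / (11 * (m : ℝ)) := by positivity
  have hQ : s.2.PosDef := hs.inv_eq ▸ hs.posDef.inv
  obtain ⟨r, h1, h2, h3, h4⟩ := call_spec method hn hA hQ hε hK hN
  obtain ⟨x, y⟩ := r
  rw [imageBody, ops_bind, iters_bind, val_bind, h1]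
  simp only [ops_bind, iters_bind, val_bind, mulVec_ops, mulVec_iters, mulVec_val, allPos_ops,
    allPos_iters, allPos_val_iff]
  split_ifs with hpos
  · refine ⟨?_, ?_, ?_⟩
    · rw [ops_pure, mul_comm n m]
      generalize n * (2 * (m * m) + 2 * m + 1) + 1 + m * (m * (3 * n + 2)) +
        m * (5 * (m * m) + m + 1) = X
      omega
    · rw [iters_pure]; omega
    · exact ⟨_, rfl, hpos⟩
  · refine ⟨?_, ?_, ?_⟩
    · rw [ops_bind, ops_pure, rescale_ops, mul_comm n m]
      omega
    · rw [iters_bind, iters_pure, rescale_iters]; omega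
    · have hout : x ∈ stdSimplex ℝ (Fin n) ∧ y = (normalizeColumns A s.2).val *ᵥ x ∧
          √(y ⬝ᵥ (s.2 *ᵥ y)) ≤ 1 / (11 * (m : ℝ)) := by
        -- The columns of `B` are nonnegative multiples of those of `A`, so positive scores would
        -- have stopped the algorithm; only a short `y` leads to a rescaling.
        rcases h2 with h2 | h2
        · refine absurd (fun j => ?_) hpos
          have h5 : 0 < (normalizeColumns A s.2).val.col j ⬝ᵥ (s.2 *ᵥ y) := h2 j
          rw [normalizeColumns_col, smul_dotProduct, smul_eq_mul] at h5
          exact pos_of_mul_pos_right h5 (inv_nonneg.2 (Real.sqrt_nonneg _))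
        · exact h2
      obtain ⟨hx, rfl, hnorm⟩ := hout
      have hB := fun j => normalizeColumns_sqNorm hQ (hA j)
      rw [val_bind, val_pure, rescale_val A hε hs.posDef hQ hx.1]
      set B := (normalizeColumns A s.2).val with hBd
      rw [hs.inv_eq] at hB hnorm
      refine ⟨rescaled_posDef B hε hs.posDef hx.1, rfl, ?_, fun z hz => ?_⟩
      · refine le_trans ?_ (det_rescaled_ge hm B hs.posDef hx hB)
        have := mul_le_mul_of_nonneg_left hs.det_ge (Real.exp_pos (1 / 2)).le
        refine le_trans (le_of_eq ?_) this
        rw [← Real.exp_add]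
        push_cast
        ring_nf
      · refine (dotProduct_rescaled_le B hε hs.posDef hx.1 hB hnorm fun j => ?_).trans
          (hs.cone_le z hz)
        rw [hBd, normalizeColumns_col, smul_dotProduct, smul_eq_mul]
        exact mul_nonneg (inv_nonneg.2 (Real.sqrt_nonneg _)) (hz j)

theorem imageAlgorithm_spec (method : FirstOrderMethod) (hm : 0 < m) (hmn : m ≤ n) {A : Mat m n}
    (hA0 : ∀ j, A.col j ≠ 0) {δ : ℝ} (hδ : 0 < δ) (hδ1 : δ ≤ 1) {y : Vec m} (hy : y ⬝ᵥ y = 1)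
    (hA : ∀ j, δ * √(A.col j ⬝ᵥ A.col j) ≤ A.col j ⬝ᵥ y) {K T : ℕ}
    (hK : 33 * m * √(Real.log (n + 1)) ≤ K)
    (hT : 2 * m * (Real.log 2 - 2 * Real.log δ) < T) :
    ∃ (N : ℕ) (y : Vec m), (imageAlgorithm method A N).val = some y ∧
      (∀ j, 0 < (Aᵀ *ᵥ y) j) ∧ (imageAlgorithm method A N).iters ≤ T * (K + 1) ∧
      (imageAlgorithm method A N).ops ≤ 2 + T * ((71 * (K + 2) + 29 * m) * (m * n)) := by
  have hm' : (0 : ℝ) < m := by exact_mod_cast hm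
  have hK' : 3 * √(Real.log (n + 1)) ≤ 1 / (11 * (m : ℝ)) * K := by
    rw [one_div, ← div_eq_inv_mul, le_div_iff₀ (by positivity)]
    linarith
  -- Large enough both for the inner loop (`K + 1` passes) and for the outer one (`T` passes).
  set N := K + 1 + T with hNd
  have hTs : ∀ s, ¬ RescalingInv A T s := fun s hs => by
    have := hs.le hδ hδ1 hy hA
    linarith
  obtain ⟨r, hr, ⟨z, rfl, hz⟩, ho, hi⟩ := loop_spec (imageBody method N A (1 / (11 * m)))
    (RescalingInv A) (fun r => ∃ y, r = some y ∧ ∀ j, 0 < (Aᵀ *ᵥ y) j) _ _ T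
    (imageBody_spec method hm (hm.trans_le hmn) hA0 hK' (by omega : K + 1 ≤ N)) hTs N 0 _
    (rescalingInv_one A) (by omega) (by omega)
  have hval : (imageAlgorithm method A N).val =
      (loop (imageBody method N A (1 / (11 * m))) N (1, 1)).val.join := rfl
  have hops : (imageAlgorithm method A N).ops =
      1 + (1 + ((loop (imageBody method N A (1 / (11 * m))) N (1, 1)).ops + 0)) := rfl
  have hiters : (imageAlgorithm method A N).iters =
      0 + (0 + ((loop (imageBody method N A (1 / (11 * m))) N (1, 1)).iters + 0)) := rfl
  refine ⟨N, z, ?_, hz, ?_, ?_⟩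
  · rw [hval, hr]; rfl
  · rw [hiters]; simpa using hi
  · have h1 : (n * (2 * (m * m) + 2 * m + 1) + m * n +
        (K + 2) * (12 * (m * m) + 20 * (m * n) + 6 * m + 25 * n + 8)) +
      (2 * (m * m) + 2 * (m * n) + n + (n * (2 * (m * m) + 2 * m + 1) + 1 +
        m * (m * (3 * n + 2)) + m * (5 * (m * m) + m + 1))) ≤
        (71 * (K + 2) + 29 * m) * (m * n) := by
      have e1 : m * m ≤ m * n := Nat.mul_le_mul_left _ hmn
      have e2 : m ≤ m * n := Nat.le_mul_of_pos_right _ (by omega)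
      have e3 : n ≤ m * n := Nat.le_mul_of_pos_left _ hm
      -- Every monomial is at most `m * n`, and the coefficients add up to `71`; in the same way the
      -- cost per round outside the iterations gives the `29`.
      have e4 : 12 * (m * m) + 20 * (m * n) + 6 * m + 25 * n + 8 ≤ 71 * (m * n) := by omega
      have e5 := Nat.mul_le_mul_left (K + 2) e4
      have f1 : m * n ≤ m * (m * n) := Nat.le_mul_of_pos_left _ hm
      have f2 : m * (m * m) ≤ m * (m * n) := Nat.mul_le_mul_left _ e1
      have f3 : m * m ≤ m * (m * n) := e1.trans f1
      have f4 : n ≤ m * (m * n) := e3.trans f1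
      have f5 : m ≤ m * (m * n) := e2.trans f1
      nlinarith
    rw [hops]
    have h2 := Nat.mul_le_mul_left (T - 0) h1
    rw [Nat.sub_zero] at h2 ho
    omega

end ImageRescaling

namespace ImageRescaling

variable {m n : ℕ}

/-! ### The Goffin measure -/

theorem euclNorm_eq_sqrt (v : Vec m) : euclNorm v = √(v ⬝ᵥ v) := by
  rw [euclNorm, EuclideanSpace.norm_eq]
  congr 1
  exact Finset.sum_congr rfl fun i _ => by rw [Real.norm_eq_abs, sq_abs, pow_two]

theorem euclNorm_nonneg (v : Vec m) : 0 ≤ euclNorm v := norm_nonneg _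

theorem euclNorm_pos {v : Vec m} (hv : v ≠ 0) : 0 < euclNorm v :=
  norm_pos_iff.2 fun h => hv (congrArg WithLp.ofLp h)

theorem euclNorm_le_sum (v : Vec m) : euclNorm v ≤ ∑ i, |v i| := by
  rw [euclNorm_eq_sqrt]
  apply Real.sqrt_le_iff.2
  refine ⟨Finset.sum_nonneg fun i _ => abs_nonneg _, ?_⟩
  rw [pow_two, Finset.sum_mul]
  refine Finset.sum_le_sum fun i hi => ?_
  rw [← abs_mul_abs_self]
  exact mul_le_mul_of_nonneg_left (Finset.single_le_sum (fun j _ => abs_nonneg (v j)) hi)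
    (abs_nonneg _)

theorem unitVec_dotProduct_unitVec (a y : Vec m) :
    unitVec a ⬝ᵥ unitVec y = (a ⬝ᵥ y) / (euclNorm a * euclNorm y) := by
  rw [unitVec, unitVec, smul_dotProduct, dotProduct_smul, smul_eq_mul, smul_eq_mul, div_eq_inv_mul,
    mul_inv, mul_assoc]

theorem unitVec_dotProduct_le_one (a y : Vec m) : unitVec a ⬝ᵥ unitVec y ≤ 1 := by
  rw [unitVec_dotProduct_unitVec]
  apply div_le_one_of_le₀ _ (mul_nonneg (euclNorm_nonneg _) (euclNorm_nonneg _))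
  have h := real_inner_le_norm (WithLp.toLp 2 y) (WithLp.toLp 2 a)
  rw [EuclideanSpace.inner_toLp_toLp, star_trivial] at h
  rw [mul_comm]
  exact h

theorem ciInf_unitVec_le_one (hn : 0 < n) (A : Mat m n) (y : Vec m) :
    ⨅ j : Fin n, unitVec (A.col j) ⬝ᵥ unitVec y ≤ 1 :=
  (ciInf_le (Set.finite_range _).bddBelow (⟨0, hn⟩ : Fin n)).trans (unitVec_dotProduct_le_one _ _)

theorem range_mulVecLin_eq_top {A : Mat m n} (hA : A.rank = m) :
    LinearMap.range A.mulVecLin = ⊤ := by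
  apply Submodule.eq_top_of_finrank_eq
  rw [Module.finrank_fin_fun]
  exact hA

theorem le_goffin (hn : 0 < n) {A : Mat m n} (hA : A.rank = m) {y : Vec m} (hy : y ≠ 0) {δ : ℝ}
    (h : ∀ j, δ ≤ unitVec (A.col j) ⬝ᵥ unitVec y) : δ ≤ goffin A := by
  have : Nonempty (Fin n) := ⟨⟨0, hn⟩⟩
  have hb : BddAbove (Set.range fun y : {y : Vec m // y ∈ LinearMap.range A.mulVecLin ∧ y ≠ 0} =>
      ⨅ j : Fin n, unitVec (A.col j) ⬝ᵥ unitVec y.1) := by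
    refine ⟨1, ?_⟩
    rintro _ ⟨z, rfl⟩
    exact ciInf_unitVec_le_one hn A z.1
  exact (le_ciInf h).trans
    (le_ciSup hb ⟨y, by rw [range_mulVecLin_eq_top hA]; exact Submodule.mem_top, hy⟩)

theorem goffin_le_one (hn : 0 < n) {A : Mat m n} (h : 0 < goffin A) : goffin A ≤ 1 := by
  rcases isEmpty_or_nonempty {y : Vec m // y ∈ LinearMap.range A.mulVecLin ∧ y ≠ 0} with he | he
  · rw [goffin, Real.iSup_of_isEmpty] at h
    exact absurd h (lt_irrefl _)
  · exact ciSup_le fun z => ciInf_unitVec_le_one hn A z.1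

/-- Strict inequality makes attainment of the supremum irrelevant. For a zero column both sides
vanish. -/
theorem exists_unit_of_lt_goffin {A : Mat m n} {δ : ℝ} (hδ : 0 < δ) (h : δ < goffin A) :
    ∃ y : Vec m, y ⬝ᵥ y = 1 ∧ ∀ j, δ * √(A.col j ⬝ᵥ A.col j) ≤ A.col j ⬝ᵥ y := by
  rcases isEmpty_or_nonempty {y : Vec m // y ∈ LinearMap.range A.mulVecLin ∧ y ≠ 0} with he | he
  · rw [goffin, Real.iSup_of_isEmpty] at h
    linarith
  obtain ⟨⟨y, _, hy⟩, hlt⟩ := exists_lt_of_lt_ciSup h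
  have hy0 := euclNorm_pos hy
  refine ⟨unitVec y, ?_, fun j => ?_⟩
  · have hs : y ⬝ᵥ y = euclNorm y * euclNorm y := by
      rw [euclNorm_eq_sqrt, Real.mul_self_sqrt]
      exact Finset.sum_nonneg fun i _ => mul_self_nonneg (y i)
    rw [unitVec_dotProduct_unitVec, hs, div_self (by positivity)]
  · have hj := hlt.le.trans (ciInf_le (Set.finite_range _).bddBelow j)
    rw [← euclNorm_eq_sqrt]
    rcases (euclNorm_nonneg (A.col j)).eq_or_lt with h0 | h0
    · have : A.col j = 0 := by
        by_contra hne
        exact (euclNorm_pos hne).ne h0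
      simp [this, euclNorm]
    · rw [unitVec, smul_dotProduct, smul_eq_mul, ← div_eq_inv_mul, le_div_iff₀ h0] at hj
      exact hj

theorem goffin_pos (hn : 0 < n) {A : Mat m n} (hA : A.rank = m) {y : Vec m}
    (hy : ∀ j, 0 < A.col j ⬝ᵥ y) : 0 < goffin A := by
  have : Nonempty (Fin n) := ⟨⟨0, hn⟩⟩
  have hy0 : y ≠ 0 := fun h => by have := hy ⟨0, hn⟩; simp [h] at this
  obtain ⟨i, hi⟩ := exists_eq_ciInf_of_finite (f := fun j => unitVec (A.col j) ⬝ᵥ unitVec y)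
  refine lt_of_lt_of_le ?_ (le_goffin hn hA hy0 fun j =>
    hi.le.trans (ciInf_le (Set.finite_range _).bddBelow j))
  have ha : A.col i ≠ 0 := fun h => by have := hy i; simp [h] at this
  rw [unitVec_dotProduct_unitVec]
  exact div_pos (hy i) (mul_pos (euclNorm_pos ha) (euclNorm_pos hy0))

/-! ### Total counts in terms of the Goffin measure -/

theorem sqrt_log_add_one_ge (hn : 0 < n) : 4 / 5 ≤ √(Real.log (n + 1)) := by
  apply Real.le_sqrt_of_sq_le
  have h1 : (1 : ℝ) ≤ n := by exact_mod_cast hn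
  have h2 : Real.log 2 ≤ Real.log (n + 1) := Real.log_le_log two_pos (by linarith)
  have h3 := Real.log_two_gt_d9
  norm_num
  linarith

theorem imageAlgorithm_bounds (method : FirstOrderMethod) (hm : 0 < m) {A : Mat m n}
    (hA : A.rank = m) (hfeas : ∃ y : Vec m, ∀ j, 0 < (Aᵀ *ᵥ y) j) :
    ∃ (N : ℕ) (y : Vec m), (imageAlgorithm method A N).val = some y ∧
      (∀ j, 0 < (Aᵀ *ᵥ y) j) ∧
      ((imageAlgorithm method A N).iters : ℝ) ≤
        252 * ((m : ℝ) ^ 2 * √(Real.log (n + 1)) * (1 + Real.log (goffin A)⁻¹)) ∧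
      ((imageAlgorithm method A N).ops : ℝ) ≤
        18700 * ((m : ℝ) ^ 3 * n * √(Real.log (n + 1)) * (1 + Real.log (goffin A)⁻¹)) := by
  have hmn : m ≤ n := hA ▸ A.rank_le_width
  have hn : 0 < n := hm.trans_le hmn
  obtain ⟨y₀, hy₀⟩ := hfeas
  have hy₀' : ∀ j, 0 < A.col j ⬝ᵥ y₀ := hy₀
  have hA0 : ∀ j, A.col j ≠ 0 := fun j h => by have := hy₀' j; simp [h] at this
  have hρ := goffin_pos hn hA hy₀'
  have hρ1 := goffin_le_one hn hρ
  obtain ⟨y₁, hy₁, hA₁⟩ := exists_unit_of_lt_goffin (half_pos hρ) (half_lt_self hρ)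
  set ℓ := Real.log (goffin A)⁻¹ with hℓ
  have hℓ' : Real.log (goffin A) = -ℓ := by rw [hℓ, Real.log_inv, neg_neg]
  have hℓ0 : 0 ≤ ℓ := Real.log_nonneg ((one_le_inv₀ hρ).2 hρ1)
  set S := √(Real.log (n + 1)) with hS
  have hS45 : 4 / 5 ≤ S := sqrt_log_add_one_ge hn
  have hm1 : (1 : ℝ) ≤ m := by exact_mod_cast hm
  have hn1 : (1 : ℝ) ≤ n := by exact_mod_cast hn
  have hmS : 4 / 5 * m ≤ m * S := by nlinarith
  -- With `δ = ρ/2` the left side is `2m (3 log 2 + 2ℓ)`, and `6 log 2 < 6`.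
  have hT : 2 * m * (Real.log 2 - 2 * Real.log (goffin A / 2)) < (⌈6 * m * (1 + ℓ)⌉₊ : ℕ) := by
    refine lt_of_lt_of_le ?_ (Nat.le_ceil _)
    rw [Real.log_div hρ.ne' two_ne_zero, hℓ']
    have := Real.log_two_lt_d9
    nlinarith
  obtain ⟨N, y, h1, h2, h3, h4⟩ := imageAlgorithm_spec method hm hmn hA0 (half_pos hρ)
    (by linarith) hy₁ hA₁ (Nat.le_ceil (33 * m * S)) hT
  set K := ⌈33 * m * S⌉₊ with hKd
  set T := ⌈6 * m * (1 + ℓ)⌉₊ with hTd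
  have hK : (K : ℝ) ≤ 33 * (m * S) + 1 := by
    rw [← mul_assoc]
    exact (Nat.ceil_lt_add_one (by positivity)).le
  have hT7 : (T : ℝ) ≤ 7 * (m * (1 + ℓ)) := by
    have := (Nat.ceil_lt_add_one (a := 6 * m * (1 + ℓ)) (by positivity)).le
    nlinarith
  -- Absorbs the additive constants and the rounding in `K` into multiples of `m * S`.
  have hx : 1 ≤ m * S * (5 / 4) := by nlinarith
  refine ⟨N, y, h1, h2, ?_, ?_⟩
  · calc ((imageAlgorithm method A N).iters : ℝ) ≤ T * (K + 1) := by exact_mod_cast h3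
      _ ≤ 7 * (m * (1 + ℓ)) * (36 * (m * S)) := by
          gcongr
          linarith
      _ = _ := by ring
  · calc ((imageAlgorithm method A N).ops : ℝ) ≤ 2 + T * ((71 * (K + 2) + 29 * m) * (m * n)) := by
          exact_mod_cast h4
      _ ≤ 2 + 7 * (m * (1 + ℓ)) * (2664 * (m * S) * (m * n)) := by
          gcongr
          linarith
      _ ≤ 18700 * ((m : ℝ) ^ 3 * n * S * (1 + ℓ)) := by
          have e : 4 / 5 ≤ (m : ℝ) ^ 3 * n * S * (1 + ℓ) := by
            calc (4 / 5 : ℝ) = 1 * 1 * (4 / 5) * 1 := by norm_num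
              _ ≤ _ := by
                gcongr
                · exact one_le_pow₀ hm1
                · linarith
          linarith

/-! ### Vertices of polyhedra and the Goffin measure of integer matrices -/

/-- A polyhedron `{y | a_jᵀ y ≥ 1}` in which no nonzero vector is orthogonal to all the `a_j`
has a vertex. -/
theorem exists_vertex (a : Fin n → Vec m) (ha : ∀ d, (∀ j, a j ⬝ᵥ d = 0) → d = 0)
    {y₀ : Vec m} (hy₀ : ∀ j, 1 ≤ a j ⬝ᵥ y₀) :
    ∃ y : Vec m, (∀ j, 1 ≤ a j ⬝ᵥ y) ∧ ∀ d, (∀ j, a j ⬝ᵥ y = 1 → a j ⬝ᵥ d = 0) → d = 0 := by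
  classical
  by_contra hcon
  push Not at hcon
  -- Without a vertex, one can always move along a direction orthogonal to the tight constraints
  -- until another becomes tight, so their number would exceed `n`.
  have hgrow : ∀ k : ℕ, ∃ y : Vec m, (∀ j, 1 ≤ a j ⬝ᵥ y) ∧
      k ≤ (Finset.univ.filter fun j => a j ⬝ᵥ y = 1).card := by
    intro k
    induction k with
    | zero => exact ⟨y₀, hy₀, Nat.zero_le _⟩
    | succ k ih =>
      obtain ⟨y, hy, hk⟩ := ih
      have hd : ∃ d, (∀ j, a j ⬝ᵥ y = 1 → a j ⬝ᵥ d = 0) ∧ ∃ j, a j ⬝ᵥ d < 0 := by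
        obtain ⟨d, hd, hd0⟩ := hcon y hy
        obtain ⟨j, hj⟩ : ∃ j, a j ⬝ᵥ d ≠ 0 := by
          by_contra hall
          push Not at hall
          exact hd0 (ha d hall)
        rcases lt_or_gt_of_ne hj with hj | hj
        · exact ⟨d, hd, j, hj⟩
        · refine ⟨-d, fun i hi => ?_, j, ?_⟩
          · rw [dotProduct_neg, hd i hi, neg_zero]
          · rw [dotProduct_neg]; linarith
      obtain ⟨d, hd, j₀, hj₀⟩ := hd
      -- Ratio test: the first constraint to become tight along `d`.
      obtain ⟨i, hi, hmin⟩ := Finset.exists_min_image (Finset.univ.filter fun j => a j ⬝ᵥ d < 0)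
        (fun j => (a j ⬝ᵥ y - 1) / -(a j ⬝ᵥ d)) ⟨j₀, by simpa using hj₀⟩
      have hid : a i ⬝ᵥ d < 0 := by simpa using hi
      set t := (a i ⬝ᵥ y - 1) / -(a i ⬝ᵥ d) with ht
      have ht0 : 0 ≤ t := div_nonneg (by linarith [hy i]) (by linarith)
      refine ⟨y + t • d, fun j => ?_, ?_⟩
      · rw [dotProduct_add, dotProduct_smul, smul_eq_mul]
        rcases lt_or_ge (a j ⬝ᵥ d) 0 with h | h
        · have h1 := hmin j (by simpa using h)
          rw [le_div_iff₀ (by linarith)] at h1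
          linarith
        · have := mul_nonneg ht0 h
          linarith [hy j]
      · have hsub : (Finset.univ.filter fun j => a j ⬝ᵥ y = 1) ⊂
            Finset.univ.filter fun j => a j ⬝ᵥ (y + t • d) = 1 := by
          rw [Finset.ssubset_iff_of_subset]
          · refine ⟨i, ?_, ?_⟩
            · rw [Finset.mem_filter, dotProduct_add, dotProduct_smul, smul_eq_mul, ht]
              refine ⟨Finset.mem_univ _, ?_⟩
              rw [div_neg, neg_mul, div_mul_cancel₀ _ hid.ne]
              ring
            · rw [Finset.mem_filter]
              exact fun h => hid.ne (hd i h.2)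
          · intro j hj
            rw [Finset.mem_filter] at hj ⊢
            refine ⟨hj.1, ?_⟩
            rw [dotProduct_add, dotProduct_smul, hd j hj.2, hj.2, smul_zero, add_zero]
        have := Finset.card_lt_card hsub
        omega
  obtain ⟨y, -, hy⟩ := hgrow (n + 1)
  have := Finset.card_le_univ (Finset.univ.filter fun j => a j ⬝ᵥ y = 1)
  rw [Fintype.card_fin] at this
  omega

/-- Among vectors without a common nonzero orthogonal vector there is a basis. -/
theorem exists_isUnit_det_of_trivial_orthogonal {ι : Type*} [Fintype ι] (v : ι → Vec m)
    (hv : ∀ d, (∀ j, v j ⬝ᵥ d = 0) → d = 0) :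
    ∃ f : Fin m → ι, Function.Injective f ∧
      IsUnit (Matrix.of fun i k => v (f i) k).det := by
  classical
  have hspan : Submodule.span ℝ (Set.range v) = ⊤ := by
    apply Submodule.eq_top_of_finrank_eq
    have hinj : Function.Injective (Matrix.of v).mulVecLin := by
      rw [injective_iff_map_eq_zero]
      exact fun d hd => hv d fun j => congrFun hd j
    have h1 := Matrix.rank_eq_finrank_span_row (Matrix.of v)
    rw [Matrix.rank, LinearMap.finrank_range_of_inj hinj] at h1
    exact h1.symm
  obtain ⟨κ, g, hg, hsp, hli⟩ := exists_linearIndependent' ℝ v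
  rw [hspan] at hsp
  have : Finite κ := Finite.of_injective g hg
  let := Fintype.ofFinite κ
  have hcard : Fintype.card κ = m := by
    have := Module.finrank_eq_card_basis (Module.Basis.mk hli hsp.ge)
    rw [Module.finrank_fin_fun] at this
    exact this.symm
  let e : Fin m ≃ κ := (Fintype.equivFinOfCardEq hcard).symm
  refine ⟨g ∘ e, hg.comp e.injective, ?_⟩
  rw [← Matrix.isUnit_iff_isUnit_det, ← Matrix.linearIndependent_rows_iff_isUnit]
  exact hli.comp e e.injective

/-- The terms of the Leibniz formula are, up to sign, among those of the expanded product of column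
sums, indexed by all maps instead of permutations. -/
theorem abs_det_le_prod_sum (B : Mat m m) : |B.det| ≤ ∏ i, ∑ j, |B j i| := by
  classical
  rw [Matrix.det_apply, Finset.prod_univ_sum]
  refine (Finset.abs_sum_le_sum_abs _ _).trans ?_
  have h : ∀ σ : Equiv.Perm (Fin m), |Equiv.Perm.sign σ • ∏ i, B (σ i) i| =
      ∏ i, |B (σ i) i| := by
    intro σ
    rw [← Finset.abs_prod]
    rcases Int.units_eq_one_or (Equiv.Perm.sign σ) with h | h <;> simp [h]
  simp only [h]
  rw [← Finset.sum_image (s := Finset.univ) (g := fun σ : Equiv.Perm (Fin m) => (σ : Fin m → Fin m))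
    (f := fun p => ∏ i, |B (p i) i|) fun σ _ τ _ hστ => DFunLike.coe_injective hστ]
  exact Finset.sum_le_sum_of_subset_of_nonneg (by intro p _; simp)
    fun p _ _ => Finset.prod_nonneg fun i _ => abs_nonneg _

theorem one_add_abs_le_two_pow_size (z : ℤ) : 1 + |(z : ℝ)| ≤ 2 ^ z.natAbs.size := by
  have h := Nat.lt_size_self z.natAbs
  have h1 : |(z : ℝ)| = (z.natAbs : ℝ) := by rw [Nat.cast_natAbs, Int.cast_abs]
  rw [h1]
  exact_mod_cast (by omega : 1 + z.natAbs ≤ 2 ^ z.natAbs.size)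

theorem sum_abs_le_two_pow {ι : Type*} (s : Finset ι) (b : ι → ℝ) (w : ι → ℕ)
    (h : ∀ i, 1 + |b i| ≤ 2 ^ w i) : ∑ i ∈ s, |b i| ≤ 2 ^ ∑ i ∈ s, w i := by
  rw [← Finset.prod_pow_eq_pow_sum]
  have h1 := one_add_sum_sub_le_prod s (fun i => (2 : ℝ) ^ w i) fun i => by
    linarith [h i, abs_nonneg (b i)]
  have h2 : ∑ i ∈ s, |b i| ≤ ∑ i ∈ s, ((2 : ℝ) ^ w i - 1) :=
    Finset.sum_le_sum fun i _ => by linarith [h i]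
  linarith

theorem abs_det_le_two_pow (B : Mat m m) (w : Fin m → Fin m → ℕ)
    (h : ∀ i j, 1 + |B j i| ≤ 2 ^ w i j) : |B.det| ≤ 2 ^ ∑ i, ∑ j, w i j := by
  refine (abs_det_le_prod_sum B).trans ?_
  rw [← Finset.prod_pow_eq_pow_sum]
  exact Finset.prod_le_prod (fun i _ => Finset.sum_nonneg fun j _ => abs_nonneg _)
    fun i _ => sum_abs_le_two_pow _ _ _ (h i)

theorem le_encodingLength (A : Matrix (Fin m) (Fin n) ℤ) (hn : 0 < n) :
    m ≤ encodingLength A := by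
  calc m = ∑ _i : Fin m, 1 := by simp
    _ ≤ _ := Finset.sum_le_sum fun i _ =>
      (by omega : 1 ≤ 1 + (A i ⟨0, hn⟩).natAbs.size).trans
        (Finset.single_le_sum (f := fun j => 1 + (A i j).natAbs.size)
          (fun j _ => Nat.zero_le _) (Finset.mem_univ _))

/-- A vertex solves a nonsingular integer system `M y = 1` of tight constraints. In Cramer's rule
the denominator is a nonzero integer, hence at least `1` in absolute value, and the numerator is a
determinant bounded through the encoding length. -/
theorem exists_cone_vector_of_int (A : Matrix (Fin m) (Fin n) ℤ)
    (hA : (A.map (Int.cast : ℤ → ℝ)).rank = m) {y₀ : Vec m}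
    (hy₀ : ∀ j, 0 < (A.map (Int.cast : ℤ → ℝ)).col j ⬝ᵥ y₀) :
    ∃ y : Vec m, (∀ j, 1 ≤ (A.map (Int.cast : ℤ → ℝ)).col j ⬝ᵥ y) ∧
      ∀ k, |y k| ≤ 2 ^ encodingLength A := by
  classical
  set Ar : Mat m n := A.map (Int.cast : ℤ → ℝ) with hAr
  have ha : ∀ d, (∀ j, Ar.col j ⬝ᵥ d = 0) → d = 0 := by
    intro d hd
    obtain ⟨w, hw⟩ : d ∈ LinearMap.range Ar.mulVecLin := by
      rw [range_mulVecLin_eq_top hA]; exact Submodule.mem_top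
    have h1 : d ⬝ᵥ d = 0 := by
      have h2 : Arᵀ *ᵥ d = 0 := funext fun j => hd j
      nth_rewrite 2 [← hw]
      rw [Matrix.mulVecLin_apply, Matrix.dotProduct_mulVec, ← Matrix.mulVec_transpose, h2,
        zero_dotProduct]
    exact dotProduct_self_eq_zero.1 h1
  obtain ⟨y₁, hy₁⟩ : ∃ y₁ : Vec m, ∀ j, 1 ≤ Ar.col j ⬝ᵥ y₁ := by
    rcases isEmpty_or_nonempty (Fin n) with he | he
    · exact ⟨0, fun j => (he.false j).elim⟩
    obtain ⟨i, hi⟩ := Finite.exists_min fun j => Ar.col j ⬝ᵥ y₀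
    refine ⟨(Ar.col i ⬝ᵥ y₀)⁻¹ • y₀, fun j => ?_⟩
    rw [dotProduct_smul, smul_eq_mul, le_inv_mul_iff₀ (hy₀ i), mul_one]
    exact hi j
  obtain ⟨y, hy, hvert⟩ := exists_vertex (fun j => Ar.col j) ha hy₁
  obtain ⟨f, hf, hdet⟩ := exists_isUnit_det_of_trivial_orthogonal
    (fun j : {j // Ar.col j ⬝ᵥ y = 1} => Ar.col j.1) fun d hd => hvert d fun j hj => hd ⟨j, hj⟩
  set M : Mat m m := Matrix.of fun i k => Ar.col (f i).1 k with hM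
  have hMy : M *ᵥ y = 1 := funext fun i => (f i).2
  have hdet1 : 1 ≤ |M.det| := by
    set M' : Matrix (Fin m) (Fin m) ℤ := Matrix.of fun i k => A k (f i).1 with hM'
    have h1 : M.det = (M'.det : ℝ) := by rw [Int.cast_det]; rfl
    have h2 := hdet.ne_zero
    rw [h1] at h2 ⊢
    rw [← Int.cast_abs]
    exact_mod_cast Int.one_le_abs (by exact_mod_cast h2)
  refine ⟨y, hy, fun k => ?_⟩
  have hcr : M.det * y k = M.cramer 1 k := by
    rw [← hMy, Matrix.cramer_eq_adjugate_mulVec, Matrix.mulVec_mulVec, Matrix.adjugate_mul,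
      Matrix.smul_mulVec, Matrix.one_mulVec, Pi.smul_apply, smul_eq_mul]
  have hb : |M.cramer 1 k| ≤ 2 ^ encodingLength A := by
    rw [Matrix.cramer_apply]
    -- The sign bit leaves room for the entries `1` of the replaced column, since `1 + 1 ≤ 2 ^ (1 +
    -- size)`.
    refine (abs_det_le_two_pow _ (fun i j => 1 + (A i (f j).1).natAbs.size) fun i j => ?_).trans ?_
    · rw [Matrix.updateCol_apply]
      have h1 := one_add_abs_le_two_pow_size (A i (f j).1)
      have h2 : (1 : ℝ) ≤ 2 ^ (A i (f j).1).natAbs.size := one_le_pow₀ one_le_two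
      rw [pow_add, pow_one]
      split_ifs
      · rw [Pi.one_apply, abs_one]; linarith
      · change 1 + |((A i (f j).1 : ℤ) : ℝ)| ≤ _
        linarith
    · refine pow_le_pow_right₀ one_le_two (Finset.sum_le_sum fun i _ => ?_)
      -- The rows of `M` are distinct columns of `A`, so no entry is counted twice.
      rw [← Finset.sum_image (s := Finset.univ) (g := fun j => (f j).1)
        (f := fun l => 1 + (A i l).natAbs.size) fun a _ b _ hab => hf (Subtype.ext hab)]
      exact Finset.sum_le_sum_of_subset (Finset.subset_univ _)
  rw [← hcr, abs_mul] at hb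
  nlinarith [abs_nonneg (y k)]

/-- The small vector has norm at most `m 2^L ≤ 2^(2L)` and each column at most `2^L`, while their
products are at least `1`; so every cosine is at least `2^(-3L)`, and `1 + 3L log 2 ≤ 4L`. -/
theorem log_inv_goffin_le (hm : 0 < m) {A : Matrix (Fin m) (Fin n) ℤ}
    (hA : (A.map (Int.cast : ℤ → ℝ)).rank = m)
    (hfeas : ∃ y : Vec m, ∀ j, 0 < ((A.map (Int.cast : ℤ → ℝ))ᵀ *ᵥ y) j) :
    1 + Real.log (goffin (A.map (Int.cast : ℤ → ℝ)))⁻¹ ≤ 4 * encodingLength A := by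
  have hmn : m ≤ n := hA ▸ Matrix.rank_le_width _
  have hn : 0 < n := hm.trans_le hmn
  obtain ⟨y₀, hy₀⟩ := hfeas
  obtain ⟨y, hy, hyk⟩ := exists_cone_vector_of_int A hA hy₀
  set Ar : Mat m n := A.map (Int.cast : ℤ → ℝ) with hAr
  have hmL := le_encodingLength A hn
  set L := encodingLength A with hL
  have hy0 : y ≠ 0 := fun h => by have := hy ⟨0, hn⟩; simp [h] at this; linarith
  have hmpow : (m : ℝ) ≤ 2 ^ L := by
    exact_mod_cast (Nat.lt_two_pow_self.le.trans (Nat.pow_le_pow_right two_pos hmL))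
  have hynorm : euclNorm y ≤ 2 ^ L * 2 ^ L := by
    refine (euclNorm_le_sum y).trans ((Finset.sum_le_sum fun k _ => hyk k).trans ?_)
    simp only [Finset.sum_const, Finset.card_univ, Fintype.card_fin, nsmul_eq_mul]
    gcongr
  have hcol : ∀ j, euclNorm (Ar.col j) ≤ 2 ^ L := by
    intro j
    refine (euclNorm_le_sum _).trans ((sum_abs_le_two_pow _ _
      (fun i => (A i j).natAbs.size) fun i => one_add_abs_le_two_pow_size (A i j)).trans ?_)
    refine pow_le_pow_right₀ one_le_two (Finset.sum_le_sum fun i _ => ?_)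
    refine le_trans (by omega : _ ≤ 1 + (A i j).natAbs.size) (Finset.single_le_sum
      (f := fun j => 1 + (A i j).natAbs.size) (fun j _ => Nat.zero_le _) (Finset.mem_univ j))
  have hge : (2 ^ L * (2 ^ L * 2 ^ L))⁻¹ ≤ goffin Ar := by
    refine le_goffin hn hA hy0 fun j => ?_
    have hj0 : Ar.col j ≠ 0 := fun h => by have := hy j; simp [h] at this; linarith
    have hp := mul_pos (euclNorm_pos hj0) (euclNorm_pos hy0)
    rw [unitVec_dotProduct_unitVec, inv_eq_one_div]
    have := euclNorm_nonneg y
    have := hy j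
    gcongr
    exact hcol j
  have hpos : (0 : ℝ) < (2 ^ L * (2 ^ L * 2 ^ L))⁻¹ := by positivity
  have h1 : Real.log (goffin Ar)⁻¹ ≤ 3 * L * Real.log 2 := by
    have h2 := Real.log_le_log (inv_pos.2 (hpos.trans_le hge)) (inv_anti₀ hpos hge)
    rw [inv_inv, ← pow_add, ← pow_add, Real.log_pow] at h2
    push_cast at h2
    linarith
  have h3 := Real.log_two_lt_d9
  have h4 : (1 : ℝ) ≤ L := by exact_mod_cast hm.trans_le hmL
  nlinarith

end ImageRescaling

/-! ### The main theorem -/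

theorem theorem3p4 :
    ∃ C : ℝ, 0 < C ∧ ∀ method : ImageRescaling.FirstOrderMethod,
      -- real input
      (∀ (m n : ℕ) (A : Matrix (Fin m) (Fin n) ℝ), 0 < m → A.rank = m →
        (∃ y : Fin m → ℝ, ∀ j, 0 < (Aᵀ *ᵥ y) j) →
        ∃ (N : ℕ) (y : Fin m → ℝ),
          (ImageRescaling.imageAlgorithm method A N).val = some y ∧
          (∀ j, 0 < (Aᵀ *ᵥ y) j) ∧
          ((ImageRescaling.imageAlgorithm method A N).iters : ℝ) ≤
            C * ((m : ℝ) ^ 2 * √(Real.log (n + 1)) *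
              (1 + Real.log (ImageRescaling.goffin A)⁻¹)) ∧
          ((ImageRescaling.imageAlgorithm method A N).ops : ℝ) ≤
            C * ((m : ℝ) ^ 3 * n * √(Real.log (n + 1)) *
              (1 + Real.log (ImageRescaling.goffin A)⁻¹))) ∧
      -- integer input
      (∀ (m n : ℕ) (A : Matrix (Fin m) (Fin n) ℤ), 0 < m →
        (A.map (Int.cast : ℤ → ℝ)).rank = m →
        (∃ y : Fin m → ℝ, ∀ j, 0 < ((A.map (Int.cast : ℤ → ℝ))ᵀ *ᵥ y) j) →
        ∃ (N : ℕ) (y : Fin m → ℝ),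
          (ImageRescaling.imageAlgorithm method (A.map (Int.cast : ℤ → ℝ)) N).val = some y ∧
          (∀ j, 0 < ((A.map (Int.cast : ℤ → ℝ))ᵀ *ᵥ y) j) ∧
          ((ImageRescaling.imageAlgorithm method (A.map (Int.cast : ℤ → ℝ)) N).ops : ℝ) ≤
            C * ((m : ℝ) ^ 3 * n * √(Real.log (n + 1)) *
              (ImageRescaling.encodingLength A : ℝ))) := by
  -- The integer case needs `4 · 18700 = 74800`, which exceeds the constants of the real case.
  refine ⟨80000, by norm_num, fun method => ⟨?_, ?_⟩⟩
  · intro m n A hm hA hfeas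
    obtain ⟨N, y, h1, h2, h3, h4⟩ := ImageRescaling.imageAlgorithm_bounds method hm hA hfeas
    refine ⟨N, y, h1, h2, ?_, ?_⟩
    · have h := (Nat.cast_nonneg _).trans h3
      linarith
    · have h := (Nat.cast_nonneg _).trans h4
      linarith
  · intro m n A hm hA hfeas
    obtain ⟨N, y, h1, h2, -, h4⟩ := ImageRescaling.imageAlgorithm_bounds method hm hA hfeas
    refine ⟨N, y, h1, h2, h4.trans ?_⟩
    have hL := ImageRescaling.log_inv_goffin_le hm hA hfeas
    have hP : 0 ≤ (m : ℝ) ^ 3 * n * √(Real.log (n + 1)) := by positivity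
    have h5 := mul_le_mul_of_nonneg_left hL hP
    have h6 := mul_nonneg hP (Nat.cast_nonneg (α := ℝ) (ImageRescaling.encodingLength A))
    linarith
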